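/- Let $q$ be a prime power and let $\mathbb F_q$ be the field with $q$ elements. Let $\mathrm{GLB}(\mathbb F_q)$ be the group of invertible infinite matrices $(g_{ij})_{i,j\in\mathbb N}$ over $\mathbb F_q$ having only finitely many nonzero entries below the diagonal, and let $B(\infty)$ be its subgroup of upper triangular matrices. Equip $B(\infty)$ with the compact product topology of the matrix entries and $\mathrm{GLB}(\mathbb F_q)$ with the topology of the disjoint union of the cosets $gB(\infty)$, which makes it a unimodular locally compact group. Write $G=\mathrm{GLB}(\mathbb F_q)$, $K=B(\infty)$, and let $\lambda$ be the Haar measure with $\lambda(K)=1$. The Iwahori–Hecke algebra $\mathcal H_\infty(q)$ is the convolution algebra of compactly supported locally constant $K$-bi-invariant functions $f:G\to\mathbb C$ (identified with the measures $f\,d\lambda$), with involution $f^\star(x)=\overline{f(x^{-1})}$ and transposition $f^t(x)=f(x^{-1})$. A trace on $\mathcal H_\infty(q)$ is a linear functional $\chi$ with $\chi(AB)=\chi(BA)$, $\chi(A^\star)=\overline{\chi(A)}$, $\chi(A^\star A)\ge 0$; it is indecomposable if it is not of the form $a_1\chi_1+a_2\chi_2$ with $a_1,a_2>0$ and traces $\chi_1,\chi_2$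 both not proportional to $\chi$. (By the theorem of Vershik and Kerov the indecomposable traces with $\chi(1)=1$ are the traces $\chi^{\alpha,\beta,\gamma}$.) Let $\chi$ be a nonzero indecomposable trace on $\mathcal H_\infty(q)$, and let $V_\chi$ be the Hilbert space completion of $\mathcal H_\infty(q)$ (modulo null vectors) with respect to $\langle A,B\rangle_\chi=\chi(B^\star A)$. Then: 1. The formula $\tau_\chi(A\otimes B)X=AXB^t$ ($A,B,X\in\mathcal H_\infty(q)$) defines a representation $\tau_\chi$ of the algebra $\mathcal H_\infty(q)\otimes\mathcal H_\infty(q)$ by bounded operators in $V_\chi$. 2. There is an irreducible (strongly continuous) unitary representation $\rho$ of $G\times G$ in a separable Hilbert space $H$ and a unitary isomorphism $U$ from $V_\chi$ onto the space $H^{K\times K}$ of $K\times K$-fixed vectors such that $$U\,\tau_\chi(T)\,v=\int_{G\times G}\varphi_T(x,y)\,\rho(x,y)\,Uv\;d\lambda(x)\,d\lambda(y),\qquad T\in\mathcal H_\infty(q)\otimes\mathcal H_\infty(q),\ v\in V_\chi,$$ where $T\mapsto\varphi_T$ is the linear map with $\varphi_{A\otimes B}(x,y)=A(x)B(y)$,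 which identifies $\mathcal H_\infty(q)\otimes\mathcal H_\infty(q)$ with the algebra of $K\times K$-bi-invariant compactly supported locally constant functions on $G\times G$. -/

import Mathlib

universe u

open MeasureTheory TopologicalSpace
open scoped Topology
open scoped TensorProduct ComplexConjugate ComplexOrder Pointwise

noncomputable section

namespace IwahoriHecke

/-! ### The group of almost triangular matrices -/

/-- The matrix entry `g i j` of an automorphism of the space of finite columns.  A matrix with
finitely many nonzero entries below the diagonal has finite columns, so the infinite invertible
almost triangular matrices are automorphisms of `ℕ →₀ F`; rows and columns are numbered from `0`. -/
def linEntry {F : Type u} [Field F] (g : (ℕ →₀ F) ≃ₗ[F] (ℕ →₀ F)) (i j : ℕ) : F :=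
  g (Finsupp.single j 1) i

/-- The span of the first `m` basis vectors. -/
def flag (F : Type u) [Field F] (m : ℕ) : Submodule F (ℕ →₀ F) :=
  Finsupp.supported F F (Set.Iio m)

theorem mem_flag {F : Type u} [Field F] {m : ℕ} {x : ℕ →₀ F} :
    x ∈ flag F m ↔ ∀ i, m ≤ i → x i = 0 := by
  rw [flag, Finsupp.mem_supported']
  simp

theorem single_mem_flag {F : Type u} [Field F] {m j : ℕ} (h : j < m) (c : F) :
    Finsupp.single j c ∈ flag F m := by
  rw [mem_flag]
  intro i hi
  exact Finsupp.single_eq_of_ne (by omega)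

theorem flag_induction {F : Type u} [Field F] {m : ℕ} {S : Submodule F (ℕ →₀ F)}
    (h : ∀ j < m, Finsupp.single j 1 ∈ S) : flag F m ≤ S := by
  rw [flag, Finsupp.supported_eq_span_single, Submodule.span_le]
  rintro _ ⟨j, hj, rfl⟩
  exact h j hj

instance flag_finite (F : Type u) [Field F] (m : ℕ) : Module.Finite F (flag F m) :=
  Module.Finite.equiv (Finsupp.supportedEquivFinsupp (R := F) (M := F) (Set.Iio m)).symm

theorem inv_flag {F : Type u} [Field F] {m : ℕ} {g : (ℕ →₀ F) ≃ₗ[F] (ℕ →₀ F)}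
    (h : ∀ x ∈ flag F m, g x ∈ flag F m) : ∀ x ∈ flag F m, g⁻¹ x ∈ flag F m := by
  have hle : (flag F m).map (g : (ℕ →₀ F) →ₗ[F] (ℕ →₀ F)) ≤ flag F m := by
    rintro _ ⟨x, hx, rfl⟩
    exact h x hx
  have heq := Submodule.eq_of_le_of_finrank_eq hle (LinearEquiv.finrank_map_eq g _)
  intro x hx
  rw [← heq] at hx
  obtain ⟨y, hy, rfl⟩ := hx
  have : g⁻¹ (g y) = y := g.symm_apply_apply y
  simpa [this] using hy

theorem flag_stable_iff {F : Type u} [Field F] (g : (ℕ →₀ F) ≃ₗ[F] (ℕ →₀ F)) :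
    {p : ℕ × ℕ | p.2 < p.1 ∧ linEntry g p.1 p.2 ≠ 0}.Finite ↔
      ∃ n, ∀ m, n ≤ m → ∀ x ∈ flag F m, g x ∈ flag F m := by
  constructor
  · intro h
    obtain ⟨n, hn⟩ := (h.image Prod.fst).bddAbove
    refine ⟨n + 1, fun m hm => ?_⟩
    have : flag F m ≤ (flag F m).comap (g : (ℕ →₀ F) →ₗ[F] (ℕ →₀ F)) := by
      apply flag_induction
      intro j hj
      change g _ ∈ flag F m
      rw [mem_flag]
      intro i hi
      by_contra hne
      have := hn ⟨(i, j), ⟨by simpa using by omega, hne⟩, rfl⟩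
      simp at this
      omega
    exact fun x hx => this hx
  · rintro ⟨n, hn⟩
    apply ((Set.finite_Iio n).prod (Set.finite_Iio n)).subset
    rintro ⟨i, j⟩ ⟨hij, hne⟩
    simp only at hij hne
    have hj : j < n := by
      by_contra hj
      have := mem_flag.1 (hn (j + 1) (by omega) _ (single_mem_flag (Nat.lt_succ_self j) 1)) i hij
      exact hne this
    refine ⟨?_, hj⟩
    by_contra hi
    exact hne (mem_flag.1 (hn n le_rfl _ (single_mem_flag hj 1)) i (by simpa using hi))

theorem upper_iff {F : Type u} [Field F] (g : (ℕ →₀ F) ≃ₗ[F] (ℕ →₀ F)) :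
    (∀ i j, j < i → linEntry g i j = 0) ↔ ∀ m, ∀ x ∈ flag F m, g x ∈ flag F m := by
  constructor
  · intro h m
    have : flag F m ≤ (flag F m).comap (g : (ℕ →₀ F) →ₗ[F] (ℕ →₀ F)) := by
      apply flag_induction
      intro j hj
      change g _ ∈ flag F m
      rw [mem_flag]
      intro i hi
      exact h i j (by omega)
    exact fun x hx => this hx
  · intro h i j hij
    exact mem_flag.1 (h (j + 1) _ (single_mem_flag (Nat.lt_succ_self j) 1)) i hij

/-- Invertible infinite matrices with finitely many nonzero entries below the diagonal. -/
def glbSubgroup (F : Type u) [Field F] : Subgroup ((ℕ →₀ F) ≃ₗ[F] (ℕ →₀ F)) where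
  carrier := {g | {p : ℕ × ℕ | p.2 < p.1 ∧ linEntry g p.1 p.2 ≠ 0}.Finite}
  mul_mem' := by
    intro a b ha hb
    rw [Set.mem_ofPred_eq, flag_stable_iff] at *
    obtain ⟨n, hn⟩ := ha
    obtain ⟨k, hk⟩ := hb
    exact ⟨max n k, fun m hm x hx =>
      hn m (le_trans (le_max_left _ _) hm) _ (hk m (le_trans (le_max_right _ _) hm) x hx)⟩
  one_mem' := by
    rw [Set.mem_ofPred_eq, flag_stable_iff]
    exact ⟨0, fun m _ x hx => hx⟩
  inv_mem' := by
    intro a ha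
    rw [Set.mem_ofPred_eq, flag_stable_iff] at *
    obtain ⟨n, hn⟩ := ha
    exact ⟨n, fun m hm => inv_flag (hn m hm)⟩

/-- The group `GLB(F)` of almost triangular matrices. -/
def GLB (F : Type u) [Field F] : Type u := ↥(glbSubgroup F)

instance (F : Type u) [Field F] : Group (GLB F) := inferInstanceAs (Group ↥(glbSubgroup F))

/-- The matrix entry in row `i` and column `j`. -/
def GLB.entry {F : Type u} [Field F] (g : GLB F) (i j : ℕ) : F := linEntry g.1 i j

/-- The subgroup `B(∞)` of upper triangular matrices. -/
def borelSubgroup (F : Type u) [Field F] : Subgroup (GLB F) where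
  carrier := {g | ∀ i j, j < i → g.entry i j = 0}
  mul_mem' := by
    intro a b ha hb
    have ha' := (upper_iff a.1).1 ha
    have hb' := (upper_iff b.1).1 hb
    exact (upper_iff (a * b).1).2 fun m x hx => ha' m _ (hb' m x hx)
  one_mem' := (upper_iff (1 : GLB F).1).2 fun m x hx => hx
  inv_mem' := by
    intro a ha
    have ha' := (upper_iff a.1).1 ha
    exact (upper_iff (a⁻¹).1).2 fun m => inv_flag (ha' m)

/-- The topology of `B(∞)`: the product topology on the matrix entries, `F` being discrete. -/
@[reducible]
def borelTopology (F : Type u) [Field F] : TopologicalSpace ↥(borelSubgroup F) :=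
  TopologicalSpace.induced (fun (b : ↥(borelSubgroup F)) (i j : ℕ) => (b : GLB F).entry i j)
    (@Pi.topologicalSpace ℕ (fun _ => ℕ → F) fun _ => @Pi.topologicalSpace ℕ (fun _ => F) fun _ => ⊥)

/-- The topology of `GLB(F)`: the disjoint union of the cosets `g B(∞)`, each of them carrying the
topology of `B(∞)`. -/
instance glbTopology (F : Type u) [Field F] : TopologicalSpace (GLB F) :=
  ⨆ g : GLB F, TopologicalSpace.coinduced (fun b : ↥(borelSubgroup F) => g * b) (borelTopology F)

/-- Upper triangular matrices whose first `n` columns are those of the identity. -/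
def colFix (F : Type u) [Field F] (n : ℕ) : Subgroup (GLB F) where
  carrier := {g | g ∈ borelSubgroup F ∧ ∀ x ∈ flag F n, g.1 x = x}
  mul_mem' := by
    rintro a b ⟨ha, ha'⟩ ⟨hb, hb'⟩
    refine ⟨mul_mem ha hb, fun x hx => ?_⟩
    change a.1 (b.1 x) = x
    rw [hb' x hx, ha' x hx]
  one_mem' := ⟨one_mem _, fun x _ => rfl⟩
  inv_mem' := by
    rintro a ⟨ha, ha'⟩
    refine ⟨inv_mem ha, fun x hx => ?_⟩
    have := ha' x hx
    change a.1.symm x = x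
    rw [LinearEquiv.symm_apply_eq, this]

theorem colFix_anti (F : Type u) [Field F] {m n : ℕ} (h : m ≤ n) : colFix F n ≤ colFix F m := by
  rintro a ⟨ha, ha'⟩
  exact ⟨ha, fun x hx => ha' x (mem_flag.2 fun i hi => mem_flag.1 hx i (h.trans hi))⟩

/-- A basis of neighbourhoods of the identity of `GLB(F)`. -/
abbrev glbBasis (F : Type u) [Field F] : GroupFilterBasis (GLB F) where
  sets := Set.range fun n => (colFix F n : Set (GLB F))
  nonempty := ⟨_, 0, rfl⟩
  inter_sets := by
    rintro _ _ ⟨m, rfl⟩ ⟨n, rfl⟩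
    exact ⟨_, ⟨max m n, rfl⟩, fun x hx =>
      ⟨colFix_anti F (le_max_left _ _) hx, colFix_anti F (le_max_right _ _) hx⟩⟩
  one' := by
    rintro _ ⟨n, rfl⟩
    exact one_mem _
  mul' := by
    rintro _ ⟨n, rfl⟩
    refine ⟨_, ⟨n, rfl⟩, ?_⟩
    rintro _ ⟨a, ha, b, hb, rfl⟩
    exact mul_mem ha hb
  inv' := by
    rintro _ ⟨n, rfl⟩
    exact ⟨_, ⟨n, rfl⟩, fun x hx => inv_mem hx⟩
  conj' := by
    rintro g _ ⟨n, rfl⟩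
    obtain ⟨k, hk⟩ := (flag_stable_iff g.1).1 g.2
    refine ⟨_, ⟨max k n, rfl⟩, ?_⟩
    rintro u ⟨hu, hu'⟩
    have hu2 := (upper_iff u.1).1 hu
    have key : ∀ x ∈ flag F (max k n), (g * u * g⁻¹).1 x = x := by
      intro x hx
      change g.1 (u.1 (g.1⁻¹ x)) = x
      rw [hu' _ (inv_flag (hk _ (le_max_left _ _)) x hx)]
      exact g.1.apply_symm_apply x
    refine ⟨(upper_iff (g * u * g⁻¹).1).2 fun m x hx => ?_, fun x hx => key x ?_⟩
    · rcases le_total m (max k n) with hm | hm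
      · rw [key x (mem_flag.2 fun i hi => mem_flag.1 hx i (hm.trans hi))]
        exact hx
      · have hkm := (le_max_left k n).trans hm
        exact hk m hkm _ (hu2 m _ (inv_flag (hk m hkm) x hx))
    · exact mem_flag.2 fun i hi => mem_flag.1 hx i ((le_max_right _ _).trans hi)

theorem mem_colFix_iff {F : Type u} [Field F] (b c : ↥(borelSubgroup F)) (n : ℕ) :
    (b : GLB F)⁻¹ * c ∈ colFix F n ↔ ∀ j < n, ∀ i, (c : GLB F).entry i j = (b : GLB F).entry i j := by
  constructor
  · rintro ⟨-, h⟩ j hj i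
    have h1 := h _ (single_mem_flag hj 1)
    change b.1.1.symm (c.1.1 _) = _ at h1
    rw [LinearEquiv.symm_apply_eq] at h1
    exact DFunLike.congr_fun h1 i
  · intro h
    refine ⟨mul_mem (inv_mem b.2) c.2, ?_⟩
    have : flag F n ≤ LinearMap.eqLocus
        (((b : GLB F)⁻¹ * c).1 : (ℕ →₀ F) →ₗ[F] (ℕ →₀ F)) LinearMap.id := by
      apply flag_induction
      intro j hj
      change b.1.1.symm (c.1.1 _) = _
      rw [LinearEquiv.symm_apply_eq]
      ext i
      exact h j hj i
    exact fun x hx => this hx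

theorem borel_isOpen_iff {F : Type u} [Field F] (W : Set ↥(borelSubgroup F)) :
    IsOpen[borelTopology F] W ↔ ∀ b ∈ W, ∃ n, ∀ c : ↥(borelSubgroup F), (b : GLB F)⁻¹ * c ∈ colFix F n → c ∈ W := by
  let _ : TopologicalSpace F := ⊥
  have _ : DiscreteTopology F := ⟨rfl⟩
  let _ : TopologicalSpace ↥(borelSubgroup F) := borelTopology F
  simp_rw [mem_colFix_iff]
  rw [isOpen_iff_mem_nhds]
  refine forall₂_congr fun b _ => ?_
  have hc : ∀ i j, Continuous fun c : ↥(borelSubgroup F) => (c : GLB F).entry i j := fun i j =>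
    by
    have h1 : Continuous fun (b : ↥(borelSubgroup F)) (i j : ℕ) => (b : GLB F).entry i j :=
      continuous_induced_dom
    exact (continuous_apply j).comp ((continuous_apply i).comp h1)
  constructor
  · intro h
    rw [nhds_induced, Filter.mem_comap] at h
    obtain ⟨t, ht, htW⟩ := h
    rw [nhds_pi, Filter.mem_pi] at ht
    obtain ⟨I, hI, s, hs, hst⟩ := ht
    simp only [nhds_pi, Filter.mem_pi] at hs
    choose J hJ r hr hrs using hs
    have hfin : (⋃ i ∈ I, J i).Finite := hI.biUnion fun i _ => hJ i
    obtain ⟨n, hn⟩ := hfin.bddAbove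
    refine ⟨n + 1, fun c hcb => htW (hst fun i hi => hrs i fun j hj => ?_)⟩
    have hjn : j ≤ n := hn (Set.mem_biUnion hi hj)
    change (c : GLB F).entry i j ∈ _
    rw [hcb j (by omega) i]
    exact mem_of_mem_nhds (hr i j)
  · rintro ⟨n, hn⟩
    have : (⋂ j ∈ Set.Iio n, ⋂ i ∈ Set.Iio n,
        {c : ↥(borelSubgroup F) | (c : GLB F).entry i j = (b : GLB F).entry i j}) ∈ nhds b := by
      refine (Filter.biInter_mem (Set.finite_Iio n)).2 fun j _ =>
        (Filter.biInter_mem (Set.finite_Iio n)).2 fun i _ => ?_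
      exact (hc i j).continuousAt.preimage_mem_nhds
        (t := {x | x = (b : GLB F).entry i j}) (mem_nhds_discrete.2 rfl)
    refine Filter.mem_of_superset this fun c hcb => hn c fun j hj i => ?_
    simp only [Set.mem_iInter, Set.mem_Iio] at hcb
    by_cases hi : i < n
    · exact hcb j hj i hi
    · rw [c.2 i j (by omega), b.2 i j (by omega)]

theorem glb_isOpen_iff {F : Type u} [Field F] (U : Set (GLB F)) :
    IsOpen U ↔ ∀ g ∈ U, ∃ n, ∀ u ∈ colFix F n, g * u ∈ U := by
  rw [isOpen_iSup_iff]
  simp_rw [isOpen_coinduced, borel_isOpen_iff]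
  constructor
  · intro h g hg
    obtain ⟨n, hn⟩ := h g 1 (by simpa using hg)
    exact ⟨n, fun u hu => hn ⟨u, hu.1⟩ (by simpa using hu)⟩
  · intro h g b hb
    obtain ⟨n, hn⟩ := h _ hb
    refine ⟨n, fun c hc => ?_⟩
    have := hn _ hc
    simpa [mul_assoc] using this

theorem glbTopology_eq (F : Type u) [Field F] : glbTopology F = (glbBasis F).topology := by
  refine TopologicalSpace.ext_iff.2 fun U => ?_
  refine (glb_isOpen_iff U).trans ?_
  rw [@isOpen_iff_mem_nhds (GLB F) (glbBasis F).topology U]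
  refine forall₂_congr fun g _ => ?_
  rw [((glbBasis F).nhds_hasBasis g).mem_iff]
  constructor
  · rintro ⟨n, hn⟩
    exact ⟨_, ⟨n, rfl⟩, by rintro _ ⟨u, hu, rfl⟩; exact hn u hu⟩
  · rintro ⟨_, ⟨n, rfl⟩, h⟩
    exact ⟨n, fun u hu => h ⟨u, hu, rfl⟩⟩

instance (F : Type u) [Field F] : IsTopologicalGroup (GLB F) := by
  rw [glbTopology_eq]
  exact (glbBasis F).isTopologicalGroup

theorem isOpen_borelSubgroup (F : Type u) [Field F] : IsOpen (borelSubgroup F : Set (GLB F)) := by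
  rw [glb_isOpen_iff]
  exact fun g hg => ⟨0, fun u hu => mul_mem hg hu.1⟩

/-- An upper triangular matrix with nonzero diagonal entries is invertible. -/
theorem exists_borel {F : Type u} [Field F] (M : ℕ → ℕ → F) (hM : ∀ i j, j < i → M i j = 0)
    (hd : ∀ i, M i i ≠ 0) :
    ∃ b : ↥(borelSubgroup F), ∀ i j, (b : GLB F).entry i j = M i j := by
  classical
  let col : ℕ → (ℕ →₀ F) := fun j =>
    Finsupp.onFinset (Finset.range (j + 1)) (fun i => M i j) fun i hi => by
      rw [Finset.mem_range]
      by_contra h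
      exact hi (hM i j (by omega))
  let f : (ℕ →₀ F) →ₗ[F] (ℕ →₀ F) := Finsupp.linearCombination F col
  have hf : ∀ i j, f (Finsupp.single j 1) i = M i j := by
    intro i j
    simp [f, col]
  have hflag : ∀ m, flag F m ≤ (flag F m).comap f := by
    intro m
    apply flag_induction
    intro j hj
    change f _ ∈ flag F m
    rw [mem_flag]
    intro i hi
    rw [hf, hM i j (by omega)]
  have hle : ∀ m, flag F m ≤ (flag F m).map f := by
    intro m
    induction m with
    | zero =>
      intro x hx
      have : x = 0 := by
        ext i
        exact mem_flag.1 hx i (Nat.zero_le _)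
      rw [this]
      exact zero_mem _
    | succ m ih =>
      have hsub : flag F m ≤ flag F (m + 1) := fun x hx =>
        mem_flag.2 fun i hi => mem_flag.1 hx i (by omega)
      have ih' : flag F m ≤ (flag F (m + 1)).map f := ih.trans (Submodule.map_mono hsub)
      apply flag_induction
      intro j hj
      rcases Nat.lt_succ_iff_lt_or_eq.1 hj with h | rfl
      · exact ih' (single_mem_flag h 1)
      · have h1 : f (Finsupp.single j 1) - M j j • Finsupp.single j 1 ∈ flag F j := by
          rw [mem_flag]
          intro i hi
          rw [Finsupp.sub_apply, hf, Finsupp.smul_apply]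
          rcases hi.eq_or_lt with rfl | h
          · simp
          · rw [hM i j h, Finsupp.single_eq_of_ne (by omega)]
            simp
        have h2 : f (Finsupp.single j 1) ∈ (flag F (j + 1)).map f :=
          ⟨_, single_mem_flag (Nat.lt_succ_self j) 1, rfl⟩
        have h3 : M j j • Finsupp.single j (1 : F) ∈ (flag F (j + 1)).map f := by
          have := sub_mem h2 (ih' h1)
          simpa using this
        have := Submodule.smul_mem _ (M j j)⁻¹ h3
        rwa [smul_smul, inv_mul_cancel₀ (hd j), one_smul] at this
  have hex : ∀ x : ℕ →₀ F, ∃ m, x ∈ flag F m := by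
    intro x
    obtain ⟨n, hn⟩ := x.support.bddAbove
    refine ⟨n + 1, mem_flag.2 fun i hi => ?_⟩
    by_contra h
    have := hn (Finset.mem_coe.2 (Finsupp.mem_support_iff.2 h))
    omega
  have hsurj : Function.Surjective f := by
    intro x
    obtain ⟨m, hm⟩ := hex x
    obtain ⟨y, -, hy⟩ := hle m hm
    exact ⟨y, hy⟩
  have hinj : Function.Injective f := by
    rw [injective_iff_map_eq_zero]
    intro x hx
    obtain ⟨m, hm⟩ := hex x
    let fm : flag F m →ₗ[F] flag F m := f.restrict (hflag m)
    have hs : Function.Surjective fm := by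
      rintro ⟨y, hy⟩
      obtain ⟨z, hz, rfl⟩ := hle m hy
      exact ⟨⟨z, hz⟩, rfl⟩
    have hi : Function.Injective fm :=
      OrzechProperty.injective_of_surjective_endomorphism fm hs
    have : (⟨x, hm⟩ : flag F m) = 0 := hi (Subtype.ext (by simpa [fm] using hx))
    exact congrArg Subtype.val this
  let e : (ℕ →₀ F) ≃ₗ[F] (ℕ →₀ F) := LinearEquiv.ofBijective f ⟨hinj, hsurj⟩
  have he : ∀ i j, linEntry e i j = M i j := hf
  have hup : ∀ i j, j < i → linEntry e i j = 0 := fun i j h => by rw [he, hM i j h]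
  exact ⟨⟨⟨e, (flag_stable_iff e).2 ⟨0, fun m _ => (upper_iff e).1 hup m⟩⟩, hup⟩, he⟩

theorem compactSpace_borel (F : Type u) [Field F] [Finite F] :
    @CompactSpace ↥(borelSubgroup F) (borelTopology F) := by
  let _ : TopologicalSpace F := ⊥
  have _ : DiscreteTopology F := ⟨rfl⟩
  let _ : TopologicalSpace ↥(borelSubgroup F) := borelTopology F
  let φ : ↥(borelSubgroup F) → (ℕ → ℕ → F) := fun b i j => (b : GLB F).entry i j
  have hφ : Topology.IsInducing φ := ⟨rfl⟩
  have hrange : Set.range φ = {M | (∀ i j, j < i → M i j = 0) ∧ ∀ i, M i i ≠ 0} := by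
    ext M
    constructor
    · rintro ⟨b, rfl⟩
      refine ⟨b.2, fun i hi => ?_⟩
      have hb := (upper_iff b.1.1).1 b.2
      have h1 : b.1.1 (Finsupp.single i 1) ∈ flag F i := by
        rw [mem_flag]
        intro k hk
        rcases hk.eq_or_lt with rfl | h
        · exact hi
        · exact b.2 k i h
      have h2 := inv_flag (hb i) _ h1
      have h3 : b.1.1⁻¹ (b.1.1 (Finsupp.single i 1)) = Finsupp.single i 1 :=
        b.1.1.symm_apply_apply _
      rw [h3] at h2
      have := mem_flag.1 h2 i le_rfl
      simp at this
    · rintro ⟨h1, h2⟩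
      obtain ⟨b, hb⟩ := exists_borel M h1 h2
      exact ⟨b, funext fun i => funext fun j => hb i j⟩
  have hc : ∀ i j, Continuous fun M : ℕ → ℕ → F => M i j := fun i j =>
    (continuous_apply j).comp (continuous_apply i)
  have hclosed : IsClosed (Set.range φ) := by
    rw [hrange, Set.ofPred_and, Set.ofPred_forall, Set.ofPred_forall]
    refine IsClosed.inter (isClosed_iInter fun i => ?_) (isClosed_iInter fun i => ?_)
    · simp_rw [Set.ofPred_forall]
      exact isClosed_iInter fun j => isClosed_iInter fun _ =>
        (isClosed_discrete ({0} : Set F)).preimage (hc i j)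
    · exact (isClosed_discrete ({0}ᶜ : Set F)).preimage (hc i i)
  exact ⟨hφ.isCompact_iff.2 (by simpa [Set.image_univ] using hclosed.isCompact)⟩

theorem isCompact_borelSubgroup (F : Type u) [Field F] [Finite F] :
    IsCompact (borelSubgroup F : Set (GLB F)) := by
  let _ : TopologicalSpace ↥(borelSubgroup F) := borelTopology F
  have _ := compactSpace_borel F
  have hcont : Continuous fun b : ↥(borelSubgroup F) => (1 : GLB F) * b :=
    continuous_iff_coinduced_le.2 (le_iSup (fun g : GLB F => TopologicalSpace.coinduced
      (fun b : ↥(borelSubgroup F) => g * b) (borelTopology F)) 1)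
  have := isCompact_range hcont
  simp only [one_mul] at this
  convert this
  ext x
  exact ⟨fun hx => ⟨⟨x, hx⟩, rfl⟩, by rintro ⟨b, rfl⟩; exact b.2⟩

/-! ### The convolution algebra of bi-invariant functions -/

/-- A compact open subgroup of a topological group. -/
structure CompactOpenSubgroup (G : Type u) [Group G] [TopologicalSpace G] where
  toSubgroup : Subgroup G
  isCompact : IsCompact (toSubgroup : Set G)
  isOpen : IsOpen (toSubgroup : Set G)

/-- The product of two compact open subgroups. -/
def CompactOpenSubgroup.prod {G : Type u} [Group G] [TopologicalSpace G]
    (K L : CompactOpenSubgroup G) : CompactOpenSubgroup (G × G) where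
  toSubgroup := K.toSubgroup.prod L.toSubgroup
  isCompact := K.isCompact.prod L.isCompact
  isOpen := K.isOpen.prod L.isOpen

/-- `B(∞)` as a compact open subgroup of `GLB(F)`. -/
def borelB (F : Type u) [Field F] [Finite F] : CompactOpenSubgroup (GLB F) where
  toSubgroup := borelSubgroup F
  isCompact := isCompact_borelSubgroup F
  isOpen := isOpen_borelSubgroup F

section HaarMeasure

variable {G : Type u} [Group G] [TopologicalSpace G] [IsTopologicalGroup G]

/-- The left Haar measure on the Borel sets of `G` that gives `K` measure `1`. -/
def CompactOpenSubgroup.haar (K : CompactOpenSubgroup G) : @Measure G (borel G) :=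
  letI : MeasurableSpace G := borel G
  haveI : BorelSpace G := ⟨rfl⟩
  Measure.haarMeasure ⟨⟨K.toSubgroup, K.isCompact⟩,
    ⟨1, by simp [K.isOpen.interior_eq]⟩⟩

theorem CompactOpenSubgroup.integral_mul_left (K : CompactOpenSubgroup G) (f : G → ℂ) (g : G) :
    ∫ y, f (g * y) ∂K.haar = ∫ y, f y ∂K.haar := by
  let _ : MeasurableSpace G := borel G
  have _ : BorelSpace G := ⟨rfl⟩
  unfold CompactOpenSubgroup.haar
  exact integral_mul_left_eq_self f g

theorem CompactOpenSubgroup.integrable (K : CompactOpenSubgroup G) {f : G → ℂ}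
    (hf : Continuous f) (hc : HasCompactSupport f) : Integrable f K.haar := by
  let _ : MeasurableSpace G := borel G
  have _ : BorelSpace G := ⟨rfl⟩
  unfold CompactOpenSubgroup.haar
  exact hf.integrable_of_hasCompactSupport hc

theorem CompactOpenSubgroup.integral_swap (K : CompactOpenSubgroup G) {f : G → G → ℂ}
    (hf : Continuous f.uncurry) (hc : HasCompactSupport f.uncurry) :
    ∫ x, (∫ y, f x y ∂K.haar) ∂K.haar = ∫ y, (∫ x, f x y ∂K.haar) ∂K.haar := by
  let _ : MeasurableSpace G := borel G
  have _ : BorelSpace G := ⟨rfl⟩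
  unfold CompactOpenSubgroup.haar
  exact integral_integral_swap_of_hasCompactSupport hf hc

theorem CompactOpenSubgroup.haar_self (K : CompactOpenSubgroup G) :
    K.haar (K.toSubgroup : Set G) = 1 := by
  let _ : MeasurableSpace G := borel G
  have _ : BorelSpace G := ⟨rfl⟩
  unfold CompactOpenSubgroup.haar
  exact Measure.haarMeasure_self

end HaarMeasure

section Hecke

variable {G : Type u} [Group G] [TopologicalSpace G]

/-- The locally constant compactly supported functions on `G` that are bi-invariant under `K`.
The function `f` stands for the bi-invariant measure with density `f` with respect to `K.haar`. -/
def heckeSubmodule (K : CompactOpenSubgroup G) : Submodule ℂ (G → ℂ) where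
  carrier := {f | IsLocallyConstant f ∧ HasCompactSupport f ∧
    ∀ k ∈ K.toSubgroup, ∀ l ∈ K.toSubgroup, ∀ g, f (k * g * l) = f g}
  add_mem' := by
    rintro a b ⟨ha, ha', ha''⟩ ⟨hb, hb', hb''⟩
    exact ⟨ha.add hb, ha'.add hb', fun k hk l hl g => by
      rw [Pi.add_apply, Pi.add_apply, ha'' k hk l hl, hb'' k hk l hl]⟩
  zero_mem' := ⟨IsLocallyConstant.const 0, HasCompactSupport.zero, fun _ _ _ _ _ => rfl⟩
  smul_mem' := by
    rintro c a ⟨ha, ha', ha''⟩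
    refine ⟨ha.comp fun z => c * z, ?_, fun k hk l hl g => ?_⟩
    · exact ha'.comp_left (g := fun z => c * z) (mul_zero c)
    · rw [Pi.smul_apply, Pi.smul_apply, ha'' k hk l hl]

/-- The algebra of `K`-bi-invariant compactly supported locally constant functions on `G`. -/
def Hecke (K : CompactOpenSubgroup G) : Type u := ↥(heckeSubmodule K)

variable {K : CompactOpenSubgroup G}

instance : AddCommGroup (Hecke K) := inferInstanceAs (AddCommGroup ↥(heckeSubmodule K))

instance : Module ℂ (Hecke K) := inferInstanceAs (Module ℂ ↥(heckeSubmodule K))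

instance : CoeFun (Hecke K) fun _ => G → ℂ := ⟨fun f => f.1⟩

namespace Hecke

theorem ext {f g : Hecke K} (h : ∀ x, f x = g x) : f = g := Subtype.ext (funext h)

@[simp] theorem add_apply (f g : Hecke K) (x : G) : (f + g) x = f x + g x := rfl

@[simp] theorem zero_apply (x : G) : (0 : Hecke K) x = 0 := rfl

@[simp] theorem smul_apply (c : ℂ) (f : Hecke K) (x : G) : (c • f) x = c * f x := rfl

theorem continuous (f : Hecke K) : Continuous f := f.2.1.continuous

theorem compactSupport (f : Hecke K) : HasCompactSupport f := f.2.2.1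

theorem biInv (f : Hecke K) {k l : G} (hk : k ∈ K.toSubgroup) (hl : l ∈ K.toSubgroup) (g : G) :
    f (k * g * l) = f g := f.2.2.2 k hk l hl g

variable [IsTopologicalGroup G]

theorem isLocallyConstant_of_inv {f : G → ℂ}
    (h : ∀ k ∈ K.toSubgroup, ∀ l ∈ K.toSubgroup, ∀ g, f (k * g * l) = f g) :
    IsLocallyConstant f := by
  rw [IsLocallyConstant.iff_exists_open]
  intro x
  refine ⟨(fun y => x⁻¹ * y) ⁻¹' K.toSubgroup, K.isOpen.preimage (continuous_const_mul _), ?_, ?_⟩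
  · simp [K.toSubgroup.one_mem]
  · intro y hy
    have := h 1 K.toSubgroup.one_mem _ hy x
    simpa using this

/-- Convolution with respect to the Haar measure normalized on `K`. -/
def conv (f g : Hecke K) (x : G) : ℂ := ∫ y, f y * g (y⁻¹ * x) ∂K.haar

theorem integrable_conv (f g : Hecke K) (x : G) :
    Integrable (fun y => f y * g (y⁻¹ * x)) K.haar :=
  K.integrable (f.continuous.mul (g.continuous.comp (continuous_inv.mul continuous_const)))
    f.compactSupport.mul_right

theorem conv_eq_zero (f g : Hecke K) {x : G} (hx : x ∉ tsupport f * tsupport g) :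
    conv f g x = 0 := by
  have : (fun y => f y * g (y⁻¹ * x)) = fun _ => 0 := by
    funext y
    by_contra h
    refine hx ⟨y, subset_tsupport _ (left_ne_zero_of_mul h), y⁻¹ * x,
      subset_tsupport _ (right_ne_zero_of_mul h), by simp⟩
  rw [conv, this, integral_zero]

theorem conv_mem (f g : Hecke K) : conv f g ∈ heckeSubmodule K := by
  have hinv : ∀ k ∈ K.toSubgroup, ∀ l ∈ K.toSubgroup, ∀ x,
      conv f g (k * x * l) = conv f g x := by
    intro k hk l hl x
    unfold conv
    rw [← K.integral_mul_left _ k]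
    congr 1
    funext y
    have h1 : f (k * y) = f y := by simpa using f.biInv hk K.toSubgroup.one_mem y
    have h2 : g ((k * y)⁻¹ * (k * x * l)) = g (y⁻¹ * x) := by
      have := g.biInv K.toSubgroup.one_mem hl (y⁻¹ * x)
      rw [← this]
      group
    rw [h1, h2]
  exact ⟨isLocallyConstant_of_inv hinv,
    HasCompactSupport.intro (f.compactSupport.isCompact.mul g.compactSupport.isCompact)
      fun x hx => conv_eq_zero f g hx, hinv⟩

instance : Mul (Hecke K) := ⟨fun f g => ⟨conv f g, conv_mem f g⟩⟩

theorem mul_apply (f g : Hecke K) (x : G) :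
    (f * g) x = ∫ y, f y * g (y⁻¹ * x) ∂K.haar := rfl

/-- The unit: the density of the normalized Haar measure of `K`. -/
instance : One (Hecke K) where
  one := ⟨Set.indicator K.toSubgroup fun _ => 1, by
    have hinv : ∀ k ∈ K.toSubgroup, ∀ l ∈ K.toSubgroup, ∀ x,
        Set.indicator (K.toSubgroup : Set G) (fun _ => (1 : ℂ)) (k * x * l) =
          Set.indicator (K.toSubgroup : Set G) (fun _ => (1 : ℂ)) x := by
      intro k hk l hl x
      have : k * x * l ∈ (K.toSubgroup : Set G) ↔ x ∈ (K.toSubgroup : Set G) := by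
        simp only [SetLike.mem_coe]
        rw [K.toSubgroup.mul_mem_cancel_right hl, K.toSubgroup.mul_mem_cancel_left hk]
      by_cases h : x ∈ (K.toSubgroup : Set G)
      · rw [Set.indicator_of_mem h, Set.indicator_of_mem (this.2 h)]
      · rw [Set.indicator_of_notMem h, Set.indicator_of_notMem fun h' => h (this.1 h')]
    exact ⟨isLocallyConstant_of_inv hinv,
      HasCompactSupport.intro K.isCompact fun x hx => Set.indicator_of_notMem hx _, hinv⟩⟩

theorem one_apply (x : G) : (1 : Hecke K) x = Set.indicator K.toSubgroup (fun _ => 1) x := rfl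

theorem integral_one : ∫ y, (1 : Hecke K) y ∂K.haar = 1 := by
  have hK := K.haar_self
  let _ : MeasurableSpace G := borel G
  have _ : BorelSpace G := ⟨rfl⟩
  simp only [one_apply]
  rw [integral_indicator K.isOpen.measurableSet]
  simp [Measure.real, hK]

theorem one_mul' (f : Hecke K) : 1 * f = f := by
  apply ext
  intro x
  have : ∀ y, (1 : Hecke K) y * f (y⁻¹ * x) = (1 : Hecke K) y * f x := by
    intro y
    by_cases h : y ∈ (K.toSubgroup : Set G)
    · have := f.biInv (K.toSubgroup.inv_mem h) K.toSubgroup.one_mem x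
      rw [mul_one] at this
      rw [this]
    · rw [one_apply, Set.indicator_of_notMem h, zero_mul, zero_mul]
  rw [mul_apply]
  simp_rw [this]
  rw [integral_mul_const, integral_one, one_mul]

theorem mul_one' (f : Hecke K) : f * 1 = f := by
  apply ext
  intro x
  have : ∀ y, f (x * y) * (1 : Hecke K) ((x * y)⁻¹ * x) = f x * (1 : Hecke K) y := by
    intro y
    have e : (x * y)⁻¹ * x = y⁻¹ := by group
    rw [e]
    by_cases h : y ∈ (K.toSubgroup : Set G)
    · have := f.biInv K.toSubgroup.one_mem h x
      rw [one_mul] at this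
      rw [this, one_apply, one_apply, Set.indicator_of_mem h,
        Set.indicator_of_mem (K.toSubgroup.inv_mem h)]
    · have h' : y⁻¹ ∉ (K.toSubgroup : Set G) := fun h' => h (by simpa using h')
      rw [one_apply, one_apply, Set.indicator_of_notMem h, Set.indicator_of_notMem h',
        mul_zero, mul_zero]
  rw [mul_apply, ← K.integral_mul_left _ x]
  simp_rw [this]
  rw [integral_const_mul, integral_one, mul_one]

theorem mul_assoc' (f g h : Hecke K) : f * g * h = f * (g * h) := by
  apply ext
  intro x
  have h1 : (f * g * h) x =
      ∫ z, (∫ y, f y * g (y⁻¹ * z) * h (z⁻¹ * x) ∂K.haar) ∂K.haar := by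
    rw [mul_apply]
    congr 1
    funext z
    rw [mul_apply, integral_mul_const]
  have h2 : (f * (g * h)) x =
      ∫ y, (∫ z, f y * g (y⁻¹ * z) * h (z⁻¹ * x) ∂K.haar) ∂K.haar := by
    rw [mul_apply]
    congr 1
    funext y
    rw [mul_apply, ← K.integral_mul_left _ y⁻¹, ← integral_const_mul]
    congr 1
    funext z
    have e : (y⁻¹ * z)⁻¹ * (y⁻¹ * x) = z⁻¹ * x := by group
    rw [e, mul_assoc]
  rw [h1, h2]
  apply K.integral_swap
  · have c1 : Continuous fun p : G × G => f p.2 := f.continuous.comp continuous_snd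
    have c2 : Continuous fun p : G × G => g (p.2⁻¹ * p.1) :=
      g.continuous.comp (continuous_snd.inv.mul continuous_fst)
    have c3 : Continuous fun p : G × G => h (p.1⁻¹ * x) :=
      h.continuous.comp (continuous_fst.inv.mul continuous_const)
    exact (c1.mul c2).mul c3
  · refine HasCompactSupport.intro
      ((f.compactSupport.isCompact.mul g.compactSupport.isCompact).prod
        f.compactSupport.isCompact) ?_
    rintro ⟨z, y⟩ hp
    by_contra hne
    have hne' : f y * g (y⁻¹ * z) * h (z⁻¹ * x) ≠ 0 := hne
    have hf := left_ne_zero_of_mul (left_ne_zero_of_mul hne')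
    have hg := right_ne_zero_of_mul (left_ne_zero_of_mul hne')
    exact hp ⟨⟨y, subset_tsupport _ hf, y⁻¹ * z, subset_tsupport _ hg, by simp⟩,
      subset_tsupport _ hf⟩

theorem left_distrib' (f g h : Hecke K) : f * (g + h) = f * g + f * h := by
  apply ext
  intro x
  simp only [mul_apply, add_apply, mul_add]
  exact integral_add (integrable_conv f g x) (integrable_conv f h x)

theorem right_distrib' (f g h : Hecke K) : (f + g) * h = f * h + g * h := by
  apply ext
  intro x
  simp only [mul_apply, add_apply, add_mul]
  exact integral_add (integrable_conv f h x) (integrable_conv g h x)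

instance : Ring (Hecke K) :=
  { (inferInstance : AddCommGroup (Hecke K)) with
    mul := (· * ·)
    one := 1
    mul_assoc := mul_assoc'
    one_mul := one_mul'
    mul_one := mul_one'
    left_distrib := left_distrib'
    right_distrib := right_distrib'
    zero_mul := fun f => ext fun x => by simp [mul_apply]
    mul_zero := fun f => ext fun x => by simp [mul_apply] }

instance : Algebra ℂ (Hecke K) :=
  Algebra.ofModule
    (fun c f g => ext fun x => by
      simp only [mul_apply, smul_apply, mul_assoc]
      exact integral_const_mul c _)
    (fun c f g => ext fun x => by
      simp only [mul_apply, smul_apply, mul_left_comm _ c]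
      exact integral_const_mul c _)

theorem inv_mem (f : Hecke K) : (fun x => f x⁻¹) ∈ heckeSubmodule K := by
  have hinv : ∀ k ∈ K.toSubgroup, ∀ l ∈ K.toSubgroup, ∀ x, f (k * x * l)⁻¹ = f x⁻¹ := by
    intro k hk l hl x
    rw [← f.biInv (K.toSubgroup.inv_mem hl) (K.toSubgroup.inv_mem hk) x⁻¹]
    group
  exact ⟨isLocallyConstant_of_inv hinv,
    f.compactSupport.comp_homeomorph (Homeomorph.inv G), hinv⟩

/-- The transposition `fᵗ(x) = f(x⁻¹)`; it is the image of a measure under `x ↦ x⁻¹` when `G` is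
unimodular. -/
def transpose : Hecke K →ₗ[ℂ] Hecke K where
  toFun f := ⟨fun x => f x⁻¹, f.inv_mem⟩
  map_add' _ _ := rfl
  map_smul' _ _ := rfl

/-- The involution `f⋆(x) = conj (f(x⁻¹))`. -/
instance : Star (Hecke K) where
  star f := ⟨fun x => conj (f x⁻¹), 
    f.inv_mem.1.comp _, f.inv_mem.2.1.comp_left (map_zero _),
    fun k hk l hl x => congrArg conj (f.inv_mem.2.2 k hk l hl x)⟩

theorem star_apply (f : Hecke K) (x : G) : star f x = conj (f x⁻¹) := rfl

/-- The function `(x, y) ↦ f(x) g(y)`, i.e. the product of the measures given by `f` and `g`. -/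
def outer (f g : Hecke K) : Hecke (K.prod K) :=
  ⟨fun p => f p.1 * g p.2, by
    refine ⟨(f.2.1.comp_continuous continuous_fst).mul (g.2.1.comp_continuous continuous_snd),
      HasCompactSupport.intro (f.compactSupport.isCompact.prod g.compactSupport.isCompact) ?_, ?_⟩
    · rintro ⟨x, y⟩ hp
      by_contra hne
      have hne' : f x * g y ≠ 0 := hne
      exact hp ⟨subset_tsupport _ (left_ne_zero_of_mul hne'),
        subset_tsupport _ (right_ne_zero_of_mul hne')⟩
    · rintro k hk l hl p
      change f (k.1 * p.1 * l.1) * g (k.2 * p.2 * l.2) = f p.1 * g p.2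
      rw [f.biInv hk.1 hl.1, g.biInv hk.2 hl.2]⟩

/-- The canonical map from the tensor square of the algebra of `(G, K)` to the algebra of
`(G × G, K × K)`, `f ⊗ g ↦ ((x, y) ↦ f(x) g(y))`. -/
def ofTensor (K : CompactOpenSubgroup G) : Hecke K ⊗[ℂ] Hecke K →ₗ[ℂ] Hecke (K.prod K) :=
  TensorProduct.lift (LinearMap.mk₂ ℂ outer
    (fun f f' g => ext fun p => add_mul (f p.1) (f' p.1) (g p.2))
    (fun c f g => ext fun p => mul_assoc c (f p.1) (g p.2))
    (fun f g g' => ext fun p => mul_add (f p.1) (g p.2) (g' p.2))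
    (fun c f g => ext fun p => mul_left_comm (f p.1) c (g p.2)))

end Hecke

/-! ### Unitary representations -/

/-- A strongly continuous unitary representation of `G` in the Hilbert space `H`. -/
structure UnitaryRepr (G : Type u) [Group G] [TopologicalSpace G]
    (H : Type u) [NormedAddCommGroup H] [InnerProductSpace ℂ H] where
  toHom : G →* (H ≃ₗᵢ[ℂ] H)
  continuous_apply : ∀ v : H, Continuous fun g => toHom g v

namespace UnitaryRepr

variable {H : Type u} [NormedAddCommGroup H] [InnerProductSpace ℂ H]

/-- Irreducibility: `H ≠ 0` and there are no closed invariant subspaces except `0` and `H`. -/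
def IsIrreducible (ρ : UnitaryRepr G H) : Prop :=
  Nontrivial H ∧ ∀ S : Submodule ℂ H, IsClosed (S : Set H) →
    (∀ g, ∀ v ∈ S, ρ.toHom g v ∈ S) → S = ⊥ ∨ S = ⊤

/-- The subspace of `K`-fixed vectors. -/
def fixed (ρ : UnitaryRepr G H) (K : CompactOpenSubgroup G) : Submodule ℂ H where
  carrier := {v | ∀ k ∈ K.toSubgroup, ρ.toHom k v = v}
  add_mem' := fun ha hb k hk => by rw [map_add, ha k hk, hb k hk]
  zero_mem' := fun k _ => map_zero _
  smul_mem' := fun c v hv k hk => by rw [map_smul, hv k hk]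

/-- The operator `ρ(f) = ∫ f(g) ρ(g) dg` for `f` in the algebra of `(G, K)`. -/
def operator [IsTopologicalGroup G] (ρ : UnitaryRepr G H) {K : CompactOpenSubgroup G} (f : Hecke K) (v : H) : H :=
  ∫ g, f g • ρ.toHom g v ∂K.haar

end UnitaryRepr

/-! ### Traces and the associated Hilbert space -/

variable [IsTopologicalGroup G]

/-- A trace on the algebra of `(G, K)`. -/
structure IsTrace (χ : Hecke K →ₗ[ℂ] ℂ) : Prop where
  tracial : ∀ a b : Hecke K, χ (a * b) = χ (b * a)
  map_star : ∀ a : Hecke K, χ (star a) = conj (χ a)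
  nonneg : ∀ a : Hecke K, 0 ≤ χ (star a * a)

/-- `χ` is not a combination `a₁ χ₁ + a₂ χ₂` with `a₁, a₂ > 0` of traces that are both not
proportional to `χ`. -/
def IsIndecomposable (χ : Hecke K →ₗ[ℂ] ℂ) : Prop :=
  ¬ ∃ (χ₁ χ₂ : Hecke K →ₗ[ℂ] ℂ) (a₁ a₂ : ℝ), IsTrace χ₁ ∧ IsTrace χ₂ ∧ 0 < a₁ ∧ 0 < a₂ ∧
    χ = (a₁ : ℂ) • χ₁ + (a₂ : ℂ) • χ₂ ∧
    (¬ ∃ c : ℂ, χ₁ = c • χ) ∧ (¬ ∃ c : ℂ, χ₂ = c • χ)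

theorem Hecke.star_add' (a b : Hecke K) : star (a + b) = star a + star b :=
  Hecke.ext fun x => map_add conj (a x⁻¹) (b x⁻¹)

theorem Hecke.star_smul' (c : ℂ) (a : Hecke K) : star (c • a) = conj c • star a :=
  Hecke.ext fun x => map_mul conj c (a x⁻¹)

/-- The inner product `⟨A, B⟩ = χ(B⋆ A)`, linear in `A` and antilinear in `B`.  In Mathlib's order
of arguments this is `inner ℂ B A`. -/
@[reducible]
def IsTrace.core {χ : Hecke K →ₗ[ℂ] ℂ} (hχ : IsTrace χ) :
    PreInnerProductSpace.Core ℂ (Hecke K) where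
  inner b a := χ (star b * a)
  conj_inner_symm x y := by
    have im : ∀ a : Hecke K, (χ (star a * a)).im = 0 := fun a =>
      (Complex.nonneg_iff.1 (hχ.nonneg a)).2.symm
    have h1 := im (x + y)
    have h2 := im (x + Complex.I • y)
    have hx := im x
    have hy := im y
    rw [Hecke.star_add', add_mul, mul_add, mul_add] at h1 h2
    rw [Hecke.star_smul'] at h2
    simp only [mul_smul_comm, smul_mul_assoc, map_add, map_smul, smul_eq_mul, Complex.add_im,
      Complex.mul_im, Complex.mul_re, Complex.I_re, Complex.I_im, Complex.conj_I, Complex.neg_im,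
      Complex.neg_re] at h1 h2
    apply Complex.ext
    · rw [Complex.conj_re]
      linarith
    · rw [Complex.conj_im]
      linarith
  re_inner_nonneg x := (Complex.nonneg_iff.1 (hχ.nonneg x)).1
  add_left x y z := by rw [Hecke.star_add', add_mul, map_add]
  smul_left x y c := by rw [Hecke.star_smul', smul_mul_assoc, map_smul, smul_eq_mul]

/-- The algebra of `(G, K)` with the inner product defined by the trace `χ`. -/
def PreGNS {χ : Hecke K →ₗ[ℂ] ℂ} (_hχ : IsTrace χ) : Type u := Hecke K

instance {χ : Hecke K →ₗ[ℂ] ℂ} (hχ : IsTrace χ) : SeminormedAddCommGroup (PreGNS hχ) :=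
  @InnerProductSpace.Core.toSeminormedAddCommGroup ℂ (Hecke K) _ _ _ hχ.core

instance {χ : Hecke K →ₗ[ℂ] ℂ} (hχ : IsTrace χ) : InnerProductSpace ℂ (PreGNS hχ) :=
  @InnerProductSpace.ofCore ℂ (Hecke K) _ _ _ hχ.core

/-- The Hilbert space completion of the algebra of `(G, K)` with respect to the inner product
defined by the trace `χ`. -/
abbrev GNS {χ : Hecke K →ₗ[ℂ] ℂ} (hχ : IsTrace χ) : Type u :=
  UniformSpace.Completion (PreGNS hχ)

/-- The vector of the Hilbert space defined by an element of the algebra. -/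
def toGNS {χ : Hecke K →ₗ[ℂ] ℂ} (hχ : IsTrace χ) (X : Hecke K) : GNS hχ :=
  UniformSpace.Completion.coe' (α := PreGNS hχ) X

theorem inner_toGNS {χ : Hecke K →ₗ[ℂ] ℂ} (hχ : IsTrace χ) (A B : Hecke K) :
    inner ℂ (toGNS hχ B) (toGNS hχ A) = χ (star B * A) :=
  UniformSpace.Completion.inner_coe (𝕜 := ℂ) (E := PreGNS hχ) B A

/-- `τ` is the left-right multiplication representation `τ_χ` of the tensor square of the algebra:
it acts in the Hilbert space of `χ` by bounded operators, and `τ_χ(A ⊗ B) X = A X Bᵗ`. -/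
def IsLeftRightRepr {χ : Hecke K →ₗ[ℂ] ℂ} (hχ : IsTrace χ)
    (τ : Hecke K ⊗[ℂ] Hecke K →ₐ[ℂ] (GNS hχ →L[ℂ] GNS hχ)) : Prop :=
  ∀ A B X : Hecke K, τ (A ⊗ₜ[ℂ] B) (toGNS hχ X) = toGNS hχ (A * X * Hecke.transpose B)

end Hecke

/-- The Iwahori-Hecke algebra `H_∞(q)`, where `q` is the number of elements of `F`: the convolution
algebra of `B(∞)`-bi-invariant functions on `GLB(F)`. -/
abbrev HeckeInf (F : Type u) [Field F] [Finite F] : Type u := Hecke (borelB F)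

end IwahoriHecke

end

open IwahoriHecke

/-! ### Positive matrices invariant under a group of permutations -/

section InvariantMatrix

open scoped MatrixOrder Matrix

variable {n : Type*} [Fintype n] [DecidableEq n]

/-! The group $G$ is a directed union of subgroups $L\supseteq K$ with $L/K$ finite: the stabilizers
of all standard flags from some index on. Attaching to a function $a$ supported in $L$ the matrix
$a(x^{-1}y)$ on $L/K$ identifies such functions in the Hecke algebra with the $L$-invariant
matrices; convolution becomes the matrix product and $\star$ the conjugate transpose. The square
root of an invariant positive matrix is invariant, so an element with positive semidefinite matrix
has the form $b^\star b$ inside the algebra (`Hecke.exists_star_mul_self`). This has two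
consequences.

First, $c\cdot 1-a^\star a=b^\star b$ for a large constant $c$, so left multiplications are bounded
for every trace; right multiplications are bounded too, because $\star$ is isometric by the trace
property. This gives $\tau_\chi$.

Second, a positive functional $\Phi$ on the Hecke algebra has a bi-invariant density $\varphi$ on
$G$ whose kernel $\varphi(x^{-1}y)$ is positive semidefinite: the negative part of an invariant
matrix is invariant, so it is enough to test against matrices that come from the algebra
(`posSemidef_kernelMatrix_density`). The kernel defines a cyclic unitary representation whose
$K$-fixed vectors form the completion of the algebra for $\Phi(a^\star b)$
(`exists_unitaryRepr_of_positive`).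

The second consequence is applied to $G\times G$, $K\times K$ and the matrix coefficient of
$\tau_\chi$ at the unit vector, which makes $V_\chi$ the space of fixed vectors. For irreducibility,
the projection onto a closed invariant subspace $S$ restricts to a projection $T$ of $V_\chi$
commuting with $\tau_\chi$. Then $X\mapsto\langle TX,1\rangle$ and $X\mapsto\langle(1-T)X,1\rangle$
are traces with sum $\chi$, and indecomposability forces $T1=c\cdot1$
(`IsLeftRightRepr.exists_smul_of_commute`). As $T$ is idempotent, $c$ is $0$ or $1$, so the cyclic
vector lies in $S^\perp$ or in $S$, and $S$ is $0$ or everything. -/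

theorem Matrix.commute_toPEquiv_iff (A : Matrix n n ℂ) (σ : Equiv.Perm n) :
    Commute A (σ.toPEquiv.toMatrix : Matrix n n ℂ) ↔ ∀ x y, A (σ x) (σ y) = A x y := by
  rw [commute_iff_eq, PEquiv.mul_toMatrix_toPEquiv, PEquiv.toMatrix_toPEquiv_mul]
  constructor
  · intro h x y
    have := congrFun (congrFun h x) (σ y)
    simpa using this.symm
  · intro h
    ext x y
    have := h x (σ.symm y)
    simpa using this.symm

/-- Invariance under `σ` means commuting with its permutation matrix, and whatever commutes with `A`
commutes with the functional calculus of `A`. -/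
theorem Matrix.PosSemidef.exists_invariant_sqrt {A : Matrix n n ℂ} (hA : A.PosSemidef) :
    ∃ B : Matrix n n ℂ, B.IsHermitian ∧ B * B = A ∧
      ∀ σ : Equiv.Perm n, (∀ x y, A (σ x) (σ y) = A x y) → ∀ x y, B (σ x) (σ y) = B x y := by
  refine ⟨CFC.sqrt A, (Matrix.nonneg_iff_posSemidef.1 (CFC.sqrt_nonneg A)).1,
    CFC.sqrt_mul_sqrt_self A hA.nonneg, fun σ hσ => ?_⟩
  rw [← Matrix.commute_toPEquiv_iff] at hσ ⊢
  exact hσ.cfcₙ_nnreal _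

/-- The test matrix $N=Q^-$ suffices: $\operatorname{tr}(QQ^-)=-\operatorname{tr}((Q^-)^2)\le0$, and
equality forces $Q^-=0$. Being a function of $Q$, this $N$ has every symmetry of $Q$. -/
theorem Matrix.IsHermitian.posSemidef_of_trace_invariant {Q : Matrix n n ℂ} (hQ : Q.IsHermitian)
    (h : ∀ N : Matrix n n ℂ, N.PosSemidef →
      (∀ σ : Equiv.Perm n, (∀ x y, Q (σ x) (σ y) = Q x y) → ∀ x y, N (σ x) (σ y) = N x y) →
      0 ≤ (Q * N).trace) : Q.PosSemidef := by
  have h1 := h Q⁻ (Matrix.nonneg_iff_posSemidef.1 (CFC.negPart_nonneg Q)) (fun σ hσ => by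
    rw [← Matrix.commute_toPEquiv_iff] at hσ ⊢
    exact hσ.cfcₙ_real _)
  have hneg : (Q⁻).IsHermitian := (Matrix.nonneg_iff_posSemidef.1 (CFC.negPart_nonneg Q)).1
  have hsub : Q⁺ - Q⁻ = Q := CFC.posPart_sub_negPart Q hQ
  have h2 : Q * Q⁻ = -((Q⁻)ᴴ * Q⁻) := by
    rw [hneg.eq]
    conv_lhs => rw [← hsub]
    rw [sub_mul, hsub, CFC.posPart_mul_negPart, zero_sub]
  have h3 : ((Q⁻)ᴴ * Q⁻).trace = 0 := by
    refine le_antisymm ?_ (Matrix.posSemidef_conjTranspose_mul_self _).trace_nonneg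
    rw [h2, Matrix.trace_neg] at h1
    simpa using h1
  have h4 : Q⁻ = 0 := Matrix.trace_conjTranspose_mul_self_eq_zero_iff.1 h3
  rw [← hsub, h4, sub_zero]
  exact Matrix.nonneg_iff_posSemidef.1 (CFC.posPart_nonneg Q)

end InvariantMatrix

namespace IwahoriHecke

/-! ### Integrals of right invariant functions -/

section Integral

variable {G : Type u} [Group G] [TopologicalSpace G] [IsTopologicalGroup G]

theorem CompactOpenSubgroup.haar_coset (K : CompactOpenSubgroup G) (g : G) :
    K.haar {x | g⁻¹ * x ∈ K.toSubgroup} = 1 := by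
  rw [← K.haar_self]
  let _ : MeasurableSpace G := borel G
  have _ : BorelSpace G := ⟨rfl⟩
  unfold CompactOpenSubgroup.haar
  exact measure_preimage_mul _ g⁻¹ (K.toSubgroup : Set G)

/-- The integral of a right invariant function supported by finitely many cosets. -/
theorem CompactOpenSubgroup.integral_eq_sum (K : CompactOpenSubgroup G) {E : Type*}
    [NormedAddCommGroup E] [NormedSpace ℝ E] [CompleteSpace E] {ι : Type*} [Fintype ι]
    (r : ι → G) (hr : ∀ i j, (r i)⁻¹ * r j ∈ K.toSubgroup → i = j) (f : G → E)
    (hf : ∀ x, ∀ k ∈ K.toSubgroup, f (x * k) = f x)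
    (hs : ∀ x, f x ≠ 0 → ∃ i, (r i)⁻¹ * x ∈ K.toSubgroup) :
    ∫ x, f x ∂K.haar = ∑ i, f (r i) := by
  have hcoset := K.haar_coset
  -- The cosets `r i * K` are pairwise disjoint and `f` is constant on each of them.
  have key : f = fun x => ∑ i, Set.indicator {x | (r i)⁻¹ * x ∈ K.toSubgroup}
      (fun _ => f (r i)) x := by
    funext x
    by_cases hx : ∃ i, (r i)⁻¹ * x ∈ K.toSubgroup
    · obtain ⟨i, hi⟩ := hx
      rw [Finset.sum_eq_single i]
      · rw [Set.indicator_of_mem (s := {x | (r i)⁻¹ * x ∈ K.toSubgroup}) hi]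
        have := hf (r i) _ hi
        rwa [mul_inv_cancel_left] at this
      · intro j _ hj
        refine Set.indicator_of_notMem (s := {x | (r j)⁻¹ * x ∈ K.toSubgroup})
          (fun hjx => hj (hr j i ?_)) _
        have := mul_mem (show (r j)⁻¹ * x ∈ K.toSubgroup from hjx) (inv_mem hi)
        simpa [mul_assoc] using this
      · simp
    · have h0 : f x = 0 := by
        by_contra h
        exact hx (hs x h)
      rw [h0, Finset.sum_eq_zero]
      intro i _
      exact Set.indicator_of_notMem (s := {x | (r i)⁻¹ * x ∈ K.toSubgroup}) (fun h => hx ⟨i, h⟩) _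
  let _ : MeasurableSpace G := borel G
  have _ : BorelSpace G := ⟨rfl⟩
  have hm : ∀ i, MeasurableSet {x | (r i)⁻¹ * x ∈ K.toSubgroup} := fun i =>
    (K.isOpen.preimage (continuous_const_mul (r i)⁻¹)).measurableSet
  calc ∫ x, f x ∂K.haar
      = ∫ x, ∑ i, Set.indicator {x | (r i)⁻¹ * x ∈ K.toSubgroup}
          (fun _ => f (r i)) x ∂K.haar := by rw [← key]
    _ = ∑ i, ∫ x, Set.indicator {x | (r i)⁻¹ * x ∈ K.toSubgroup}
          (fun _ => f (r i)) x ∂K.haar := by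
        refine integral_finsetSum _ fun i _ => ?_
        rw [integrable_indicator_iff (hm i)]
        exact integrableOn_const (by rw [hcoset]; exact ENNReal.one_ne_top)
    _ = ∑ i, f (r i) := by
        refine Finset.sum_congr rfl fun i _ => ?_
        rw [integral_indicator_const _ (hm i), Measure.real, hcoset]
        simp

end Integral

/-! ### Star and transposition -/

namespace Hecke

variable {G : Type u} [Group G] [TopologicalSpace G] {K : CompactOpenSubgroup G}

theorem apply_mul_right (f : Hecke K) (x : G) {k : G} (hk : k ∈ K.toSubgroup) :
    f (x * k) = f x := by
  simpa using f.biInv K.toSubgroup.one_mem hk x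

theorem apply_mul_left (f : Hecke K) (x : G) {k : G} (hk : k ∈ K.toSubgroup) :
    f (k * x) = f x := by
  simpa using f.biInv hk K.toSubgroup.one_mem x

variable [IsTopologicalGroup G]

theorem transpose_apply (f : Hecke K) (x : G) : transpose f x = f x⁻¹ := rfl

theorem transpose_transpose (f : Hecke K) : transpose (transpose f) = f :=
  ext fun x => by rw [transpose_apply, transpose_apply, inv_inv]

/-- The substitution $y\mapsto x^{-1}y$ in $(f*g)(x^{-1})$ exchanges the two factors, so left
invariance of the Haar measure is enough here. -/
theorem transpose_mul (f g : Hecke K) : transpose (f * g) = transpose g * transpose f := by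
  apply ext
  intro x
  rw [transpose_apply, mul_apply, mul_apply, ← K.integral_mul_left _ x⁻¹]
  congr 1
  funext y
  rw [transpose_apply, transpose_apply, mul_comm]
  congr 2 <;> group

theorem one_inv_apply (x : G) : (1 : Hecke K) x⁻¹ = (1 : Hecke K) x := by
  rw [one_apply, one_apply]
  by_cases h : x ∈ (K.toSubgroup : Set G)
  · rw [Set.indicator_of_mem h, Set.indicator_of_mem (K.toSubgroup.inv_mem h)]
  · rw [Set.indicator_of_notMem h, Set.indicator_of_notMem fun h' => h (by simpa using h')]

theorem transpose_one : transpose (1 : Hecke K) = 1 := ext one_inv_apply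

theorem star_star' (f : Hecke K) : star (star f) = f :=
  ext fun x => by rw [star_apply, star_apply, inv_inv, Complex.conj_conj]

theorem star_transpose (f : Hecke K) : star (transpose f) = transpose (star f) := rfl

theorem star_mul' (f g : Hecke K) : star (f * g) = star g * star f := by
  apply ext
  intro x
  have h := congrArg conj (congrFun (congrArg Subtype.val (transpose_mul f g)) x)
  change conj ((f * g) x⁻¹) = _
  refine h.trans ?_
  change conj ((transpose g * transpose f) x) = _
  rw [mul_apply, mul_apply]
  let _ : MeasurableSpace G := borel G
  rw [← integral_conj]
  congr 1
  funext y
  rw [map_mul]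
  rfl

theorem star_one' : star (1 : Hecke K) = 1 := by
  apply ext
  intro x
  rw [star_apply, one_inv_apply, one_apply]
  by_cases h : x ∈ (K.toSubgroup : Set G)
  · rw [Set.indicator_of_mem h, map_one]
  · rw [Set.indicator_of_notMem h, map_zero]

end Hecke

/-! ### Cosets and bi-invariant kernels -/

section Cells

variable {G : Type u} [Group G] {K L : Subgroup G}

/-- The cosets of `K` that meet the subgroup `L`. -/
abbrev cells (K L : Subgroup G) : Set (G ⧸ K) := MulAction.orbit L ((1 : G) : G ⧸ K)

theorem mk_mem_cells (hKL : K ≤ L) {x : G} : (x : G ⧸ K) ∈ cells K L ↔ x ∈ L := by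
  constructor
  · rintro ⟨g, hg⟩
    have hg' : (((g : G) * 1 : G) : G ⧸ K) = x := hg
    rw [QuotientGroup.eq, mul_one] at hg'
    have := mul_mem g.2 (hKL hg')
    rwa [mul_inv_cancel_left] at this
  · intro hx
    refine ⟨⟨x, hx⟩, ?_⟩
    change ((x * 1 : G) : G ⧸ K) = x
    rw [mul_one]

theorem out_mem_of_mem_cells (hKL : K ≤ L) {c : G ⧸ K} (hc : c ∈ cells K L) : c.out ∈ L := by
  rw [← mk_mem_cells hKL]
  simpa using hc

/-- The subgroup `L` is a finite union of cosets of `K`. -/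
structure IsFiniteOver (K L : Subgroup G) : Prop where
  le : K ≤ L
  finite : (cells K L).Finite

/-- Every finite set lies in a subgroup that is a finite union of cosets of `K`. -/
def IsLocallyFiniteOver (K : Subgroup G) : Prop :=
  ∀ S : Finset G, ∃ L : Subgroup G, IsFiniteOver K L ∧ ∀ g ∈ S, g ∈ L

/-- A subgroup over $K$ that contains one representative of each coset in $L_1\cup L_2$ contains the
whole cosets, because it contains $K$. -/
theorem IsLocallyFiniteOver.directed (hK : IsLocallyFiniteOver K) {L₁ L₂ : Subgroup G}
    (h₁ : IsFiniteOver K L₁) (h₂ : IsFiniteOver K L₂) :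
    ∃ L : Subgroup G, IsFiniteOver K L ∧ L₁ ≤ L ∧ L₂ ≤ L := by
  classical
  obtain ⟨L, hL, hS⟩ := hK ((h₁.finite.union h₂.finite).toFinset.image Quotient.out)
  have key : ∀ x : G, (x : G ⧸ K) ∈ cells K L₁ ∪ cells K L₂ → x ∈ L := by
    intro x hx
    have := hS (x : G ⧸ K).out (Finset.mem_image_of_mem _ (by simpa using hx))
    rw [← mk_mem_cells hL.le] at this ⊢
    simpa using this
  exact ⟨L, hL, fun x hx => key x (Or.inl ((mk_mem_cells h₁.le).2 hx)),
    fun x hx => key x (Or.inr ((mk_mem_cells h₂.le).2 hx))⟩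

theorem IsLocallyFiniteOver.exists_cells (hK : IsLocallyFiniteOver K) (S : Finset (G ⧸ K)) :
    ∃ L : Subgroup G, IsFiniteOver K L ∧ ∀ c ∈ S, c ∈ cells K L := by
  classical
  obtain ⟨L, hL, hS⟩ := hK (S.image Quotient.out)
  refine ⟨L, hL, fun c hc => ?_⟩
  have := hS c.out (Finset.mem_image_of_mem _ hc)
  rw [← mk_mem_cells hL.le] at this
  simpa using this

/-- A function on `G` that is invariant under `K` from both sides. -/
def IsBiInvariant (K : Subgroup G) (ψ : G → ℂ) : Prop :=
  ∀ k ∈ K, ∀ l ∈ K, ∀ g, ψ (k * g * l) = ψ g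

/-- The kernel `ψ(x⁻¹ y)` on the cosets of `K`. -/
noncomputable def cosetKernel (K : Subgroup G) (ψ : G → ℂ) (c d : G ⧸ K) : ℂ :=
  ψ (c.out⁻¹ * d.out)

variable {ψ : G → ℂ}

theorem cosetKernel_mk (hψ : IsBiInvariant K ψ) (x y : G) :
    cosetKernel K ψ (x : G ⧸ K) (y : G ⧸ K) = ψ (x⁻¹ * y) := by
  obtain ⟨k, hk⟩ := QuotientGroup.mk_out_eq_mul K x
  obtain ⟨l, hl⟩ := QuotientGroup.mk_out_eq_mul K y
  rw [cosetKernel, hk, hl, ← hψ _ (inv_mem k.2) _ l.2 (x⁻¹ * y)]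
  congr 1
  group

theorem cosetKernel_smul (hψ : IsBiInvariant K ψ) (g : G) (c d : G ⧸ K) :
    cosetKernel K ψ (g • c) (g • d) = cosetKernel K ψ c d := by
  induction c using QuotientGroup.induction_on with | _ x =>
  induction d using QuotientGroup.induction_on with | _ y =>
  change cosetKernel K ψ ((g * x : G) : G ⧸ K) ((g * y : G) : G ⧸ K) = _
  rw [cosetKernel_mk hψ, cosetKernel_mk hψ]
  congr 1
  group

/-- The restriction of the kernel `ψ(x⁻¹ y)` to the cosets in `L`. -/
noncomputable def kernelMatrix (K L : Subgroup G) (ψ : G → ℂ) :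
    Matrix (cells K L) (cells K L) ℂ :=
  Matrix.of fun c d => cosetKernel K ψ c d

theorem kernelMatrix_apply (c d : cells K L) :
    kernelMatrix K L ψ c d = cosetKernel K ψ c d := rfl

theorem kernelMatrix_smul (hψ : IsBiInvariant K ψ) (g : L) (c d : cells K L) :
    kernelMatrix K L ψ (g • c) (g • d) = kernelMatrix K L ψ c d :=
  cosetKernel_smul hψ (g : G) c d

/-- The coset `K` itself. -/
def baseCell (K L : Subgroup G) : cells K L := ⟨_, MulAction.mem_orbit_self _⟩

theorem coe_baseCell : ((baseCell K L : cells K L) : G ⧸ K) = ((1 : G) : G ⧸ K) := rfl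

theorem exists_smul_baseCell (c : cells K L) : ∃ g : L, g • baseCell K L = c := by
  obtain ⟨_, g, rfl⟩ := c
  exact ⟨g, rfl⟩

/-- $L$ is transitive on its cosets of $K$, so all rows have the same sum. -/
theorem sum_sum_invariant [Fintype (cells K L)] (F : cells K L → cells K L → ℂ)
    (hF : ∀ (g : L) c d, F (g • c) (g • d) = F c d) :
    ∑ c, ∑ d, F c d = Fintype.card (cells K L) * ∑ d, F (baseCell K L) d := by
  have : ∀ c, ∑ d, F c d = ∑ d, F (baseCell K L) d := by
    intro c
    obtain ⟨g, rfl⟩ := exists_smul_baseCell c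
    rw [← Equiv.sum_comp (MulAction.toPerm g)]
    exact Finset.sum_congr rfl fun d _ => hF g _ d
  rw [Finset.sum_congr rfl fun c _ => this c, Finset.sum_const, nsmul_eq_mul]
  rfl

theorem card_cells_ne_zero [Fintype (cells K L)] : (Fintype.card (cells K L) : ℂ) ≠ 0 := by
  have : Nonempty (cells K L) := ⟨baseCell K L⟩
  exact_mod_cast Fintype.card_ne_zero

theorem card_cells_pos [Fintype (cells K L)] : (0 : ℂ) < Fintype.card (cells K L) := by
  have : Nonempty (cells K L) := ⟨baseCell K L⟩
  exact_mod_cast Fintype.card_pos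

end Cells

/-! ### Convolution as multiplication of matrices -/

section Convolution

variable {G : Type u} [Group G] [TopologicalSpace G] {K : CompactOpenSubgroup G}

theorem Hecke.isBiInvariant (a : Hecke K) : IsBiInvariant K.toSubgroup a :=
  fun _ hk _ hl g => a.biInv hk hl g

/-- The function `a` vanishes outside of `L`. -/
def Hecke.SupportedIn (a : Hecke K) (L : Subgroup G) : Prop := ∀ x, a x ≠ 0 → x ∈ L

theorem Hecke.SupportedIn.mono {a : Hecke K} {L M : Subgroup G} (h : a.SupportedIn L)
    (hLM : L ≤ M) : a.SupportedIn M := fun x hx => hLM (h x hx)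

/-- The row of the base coset lists the values of the function on $L$. -/
theorem kernelMatrix_injective {L : Subgroup G} (hL : K.toSubgroup ≤ L) {a b : Hecke K}
    (ha : a.SupportedIn L) (hb : b.SupportedIn L) (h : kernelMatrix K.toSubgroup L a = kernelMatrix K.toSubgroup L b) :
    a = b := by
  apply Hecke.ext
  intro x
  by_cases hx : x ∈ L
  · have := congrFun (congrFun h (baseCell _ _)) ⟨(x : G ⧸ K.toSubgroup), (mk_mem_cells hL).2 hx⟩
    rw [kernelMatrix_apply, kernelMatrix_apply, coe_baseCell, cosetKernel_mk a.isBiInvariant,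
      cosetKernel_mk b.isBiInvariant] at this
    simpa using this
  · have h1 : a x = 0 := by
      by_contra h
      exact hx (ha x h)
    have h2 : b x = 0 := by
      by_contra h
      exact hx (hb x h)
    rw [h1, h2]

variable [IsTopologicalGroup G] {L : Subgroup G}

theorem Hecke.SupportedIn.star {a : Hecke K} (h : a.SupportedIn L) : (star a).SupportedIn L := by
  intro x hx
  rw [Hecke.star_apply] at hx
  simpa using h x⁻¹ fun h0 => hx (by rw [h0, map_zero])

/-- Finitely many open cosets $gK$ cover the compact support. -/
theorem Hecke.exists_supportedIn (hK : IsLocallyFiniteOver K.toSubgroup) (a : Hecke K) :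
    ∃ L : Subgroup G, IsFiniteOver K.toSubgroup L ∧ a.SupportedIn L := by
  obtain ⟨t, ht⟩ := a.compactSupport.isCompact.elim_finite_subcover
    (fun g : G => {x | g⁻¹ * x ∈ K.toSubgroup})
    (fun g => K.isOpen.preimage (continuous_const_mul g⁻¹))
    (fun x _ => Set.mem_iUnion.2 ⟨x, by simp [K.toSubgroup.one_mem]⟩)
  obtain ⟨L, hL, htL⟩ := hK t
  refine ⟨L, hL, fun x hx => ?_⟩
  obtain ⟨g, hg, hgx⟩ := Set.mem_iUnion₂.1 (ht (subset_tsupport _ hx))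
  have := mul_mem (htL g hg) (hL.le hgx)
  rwa [mul_inv_cancel_left] at this

theorem Hecke.exists_supportedIn₂ (hK : IsLocallyFiniteOver K.toSubgroup) (a b : Hecke K) :
    ∃ L : Subgroup G, IsFiniteOver K.toSubgroup L ∧ a.SupportedIn L ∧ b.SupportedIn L := by
  obtain ⟨L₁, h₁, ha⟩ := a.exists_supportedIn hK
  obtain ⟨L₂, h₂, hb⟩ := b.exists_supportedIn hK
  obtain ⟨L, hL, hL₁, hL₂⟩ := hK.directed h₁ h₂
  exact ⟨L, hL, ha.mono hL₁, hb.mono hL₂⟩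

theorem integral_eq_sum_cells (hL : K.toSubgroup ≤ L) [Fintype (cells K.toSubgroup L)]
    {E : Type*} [NormedAddCommGroup E] [NormedSpace ℝ E] [CompleteSpace E] (f : G → E)
    (hf : ∀ x, ∀ k ∈ K.toSubgroup, f (x * k) = f x) (hs : ∀ x, f x ≠ 0 → x ∈ L) :
    ∫ x, f x ∂K.haar = ∑ c : cells K.toSubgroup L, f (c : G ⧸ K.toSubgroup).out := by
  refine K.integral_eq_sum _ (fun c d h => ?_) f hf fun x hx => ?_
  · rw [← QuotientGroup.eq] at h
    exact Subtype.ext (by simpa using h)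
  · refine ⟨⟨(x : G ⧸ K.toSubgroup), (mk_mem_cells hL).2 (hs x hx)⟩, ?_⟩
    rw [← QuotientGroup.eq]
    simp

/-- After translation by $g^{-1}$ the integrand is $a(g^{-1}y)\,b(y^{-1}h)$, which is right
$K$-invariant in $y$ and supported in $gL=L$. -/
theorem Hecke.mul_apply_eq_sum (hL : K.toSubgroup ≤ L) [Fintype (cells K.toSubgroup L)]
    {a : Hecke K} (ha : a.SupportedIn L) (b : Hecke K) {g : G} (hg : g ∈ L) (h : G) :
    (a * b) (g⁻¹ * h) = ∑ c : cells K.toSubgroup L,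
      a (g⁻¹ * (c : G ⧸ K.toSubgroup).out) * b ((c : G ⧸ K.toSubgroup).out⁻¹ * h) := by
  rw [mul_apply, ← K.integral_mul_left _ g⁻¹]
  have : ∀ y, (g⁻¹ * y)⁻¹ * (g⁻¹ * h) = y⁻¹ * h := fun y => by group
  simp_rw [this]
  refine integral_eq_sum_cells hL _ (fun x k hk => ?_) fun x hx => ?_
  · rw [← mul_assoc, a.apply_mul_right _ hk, mul_inv_rev, mul_assoc,
      b.apply_mul_left _ (K.toSubgroup.inv_mem hk)]
  · have := mul_mem hg (ha _ (left_ne_zero_of_mul hx))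
    rwa [mul_inv_cancel_left] at this

theorem Hecke.SupportedIn.mul (hL : IsFiniteOver K.toSubgroup L) {a b : Hecke K}
    (ha : a.SupportedIn L) (hb : b.SupportedIn L) : (a * b).SupportedIn L := by
  have _ : Fintype (cells K.toSubgroup L) := hL.finite.fintype
  intro x hx
  have h := mul_apply_eq_sum hL.le ha b L.one_mem x
  rw [inv_one, one_mul] at h
  rw [h] at hx
  obtain ⟨c, -, hc⟩ := Finset.exists_ne_zero_of_sum_ne_zero hx
  have := mul_mem (out_mem_of_mem_cells hL.le c.2) (hb _ (right_ne_zero_of_mul hc))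
  rwa [mul_inv_cancel_left] at this

/-- The support of the left factor alone confines the sum to $L/K$, so `b` may be arbitrary. -/
theorem kernelMatrix_mul (hL : K.toSubgroup ≤ L) [Fintype (cells K.toSubgroup L)]
    {a : Hecke K} (ha : a.SupportedIn L) (b : Hecke K) :
    kernelMatrix K.toSubgroup L (a * b : Hecke K) =
      kernelMatrix K.toSubgroup L a * kernelMatrix K.toSubgroup L b := by
  ext c d
  rw [Matrix.mul_apply]
  exact Hecke.mul_apply_eq_sum hL ha b (out_mem_of_mem_cells hL c.2) _

theorem kernelMatrix_star (a : Hecke K) :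
    kernelMatrix K.toSubgroup L (star a : Hecke K) =
      (kernelMatrix K.toSubgroup L a).conjTranspose := by
  ext c d
  rw [Matrix.conjTranspose_apply, kernelMatrix_apply, kernelMatrix_apply, cosetKernel, cosetKernel,
    Hecke.star_apply, mul_inv_rev, inv_inv]
  rfl

theorem kernelMatrix_one [DecidableEq (cells K.toSubgroup L)] :
    kernelMatrix K.toSubgroup L (1 : Hecke K) = 1 := by
  ext c d
  rw [kernelMatrix_apply, cosetKernel, Hecke.one_apply, Matrix.one_apply]
  have : (c : G ⧸ K.toSubgroup).out⁻¹ * (d : G ⧸ K.toSubgroup).out ∈ (K.toSubgroup : Set G) ↔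
      c = d := by
    rw [SetLike.mem_coe, ← QuotientGroup.eq, Subtype.ext_iff]
    simp
  by_cases h : c = d
  · rw [if_pos h, Set.indicator_of_mem (this.2 h)]
  · rw [if_neg h, Set.indicator_of_notMem fun h' => h (this.1 h')]

/-- The function is $x\mapsto B(K,xK)$ on $L$ and $0$ elsewhere. It is left $K$-invariant because
$K$ fixes the base coset and $B$ is invariant. -/
theorem exists_hecke_of_invariant (hL : IsFiniteOver K.toSubgroup L)
    (B : Matrix (cells K.toSubgroup L) (cells K.toSubgroup L) ℂ)
    (hB : ∀ (g : L) c d, B (g • c) (g • d) = B c d) :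
    ∃ b : Hecke K, b.SupportedIn L ∧ kernelMatrix K.toSubgroup L b = B := by
  classical
  have _ : Fintype (cells K.toSubgroup L) := hL.finite.fintype
  let f : G → ℂ := fun x => if hx : x ∈ L then
    B (baseCell _ _) ⟨(x : G ⧸ K.toSubgroup), (mk_mem_cells hL.le).2 hx⟩ else 0
  have hpos : ∀ x (hx : x ∈ L), f x =
      B (baseCell _ _) ⟨(x : G ⧸ K.toSubgroup), (mk_mem_cells hL.le).2 hx⟩ := fun x hx => dif_pos hx
  have hneg : ∀ x, x ∉ L → f x = 0 := fun x hx => dif_neg hx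
  have hinv : ∀ k ∈ K.toSubgroup, ∀ l ∈ K.toSubgroup, ∀ g, f (k * g * l) = f g := by
    intro k hk l hl g
    by_cases hg : g ∈ L
    · rw [hpos _ (mul_mem (mul_mem (hL.le hk) hg) (hL.le hl)), hpos g hg]
      refine Eq.trans ?_ (hB ⟨k, hL.le hk⟩ (baseCell _ _) _)
      congr 1
      · apply Subtype.ext
        change ((1 : G) : G ⧸ K.toSubgroup) = ((k * 1 : G) : G ⧸ K.toSubgroup)
        rw [QuotientGroup.eq]
        simpa using hk
      · apply Subtype.ext
        change ((k * g * l : G) : G ⧸ K.toSubgroup) = ((k * g : G) : G ⧸ K.toSubgroup)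
        rw [QuotientGroup.eq]
        simpa [mul_assoc] using hl
    · rw [hneg g hg, hneg]
      intro h
      rw [L.mul_mem_cancel_right (hL.le hl), L.mul_mem_cancel_left (hL.le hk)] at h
      exact hg h
  have hcompact : HasCompactSupport f := by
    refine HasCompactSupport.intro
      (K := ⋃ c : cells K.toSubgroup L, {(c : G ⧸ K.toSubgroup).out} * (K.toSubgroup : Set G))
      (isCompact_iUnion fun c => isCompact_singleton.mul K.isCompact) fun x hx => hneg x fun hxL =>
        hx ?_
    rw [Set.mem_iUnion]
    refine ⟨⟨(x : G ⧸ K.toSubgroup), (mk_mem_cells hL.le).2 hxL⟩,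
      Set.mem_mul.2 ⟨_, rfl, (x : G ⧸ K.toSubgroup).out⁻¹ * x, ?_, by simp⟩⟩
    rw [SetLike.mem_coe, ← QuotientGroup.eq]
    simp
  let b : Hecke K := ⟨f, Hecke.isLocallyConstant_of_inv hinv, hcompact, hinv⟩
  refine ⟨b, fun x hx => by_contra fun h => hx (hneg x h), ?_⟩
  ext c d
  have hc := out_mem_of_mem_cells hL.le c.2
  have hd := out_mem_of_mem_cells hL.le d.2
  rw [kernelMatrix_apply, cosetKernel]
  change f _ = _
  -- Translation by the representative of `c` carries the base coset to `c`, and $c^{-1}d$ to `d`.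
  rw [hpos _ (mul_mem (inv_mem hc) hd), ← hB ⟨_, hc⟩ (baseCell _ _)]
  congr 1
  · apply Subtype.ext
    change (((c : G ⧸ K.toSubgroup).out * 1 : G) : G ⧸ K.toSubgroup) = _
    simp
  · apply Subtype.ext
    change (((c : G ⧸ K.toSubgroup).out * ((c : G ⧸ K.toSubgroup).out⁻¹ *
      (d : G ⧸ K.toSubgroup).out) : G) : G ⧸ K.toSubgroup) = _
    simp

/-- An element of the algebra with a positive semidefinite kernel is of the form `b⋆ b`. -/
theorem Hecke.exists_star_mul_self (hL : IsFiniteOver K.toSubgroup L) {a : Hecke K}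
    (ha : a.SupportedIn L) (hpos : (kernelMatrix K.toSubgroup L a).PosSemidef) :
    ∃ b : Hecke K, a = star b * b := by
  classical
  have _ : Fintype (cells K.toSubgroup L) := hL.finite.fintype
  obtain ⟨B, hBh, hBB, hB⟩ := hpos.exists_invariant_sqrt
  -- The square root inherits the $L$-invariance, hence is the matrix of an element of the algebra
  -- supported in $L$.
  obtain ⟨b, hb, hbB⟩ := exists_hecke_of_invariant hL B fun g =>
    hB (MulAction.toPerm g) (kernelMatrix_smul a.isBiInvariant g)
  refine ⟨b, kernelMatrix_injective hL.le ha (hb.star.mul hL hb) ?_⟩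
  rw [kernelMatrix_mul hL.le hb.star, kernelMatrix_star, hbB, hBh.eq, hBB]

end Convolution

/-! ### Double cosets and the density of a linear functional -/

section Density

variable {G : Type u} [Group G] [TopologicalSpace G] {K : CompactOpenSubgroup G}

theorem Hecke.SupportedIn.sub {a b : Hecke K} {L : Subgroup G} (ha : a.SupportedIn L)
    (hb : b.SupportedIn L) : (a - b).SupportedIn L := by
  intro x hx
  by_contra h
  refine hx ?_
  change a x - b x = 0
  rw [by_contra fun h' => h (ha x h'), by_contra fun h' => h (hb x h'), sub_zero]

theorem Hecke.SupportedIn.smul {a : Hecke K} {L : Subgroup G} (ha : a.SupportedIn L) (c : ℂ) :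
    (c • a).SupportedIn L := fun x hx => ha x (right_ne_zero_of_mul hx)

/-- Evaluation at a point as a linear functional. -/
def Hecke.eval (K : CompactOpenSubgroup G) (x : G) : Hecke K →ₗ[ℂ] ℂ where
  toFun f := f x
  map_add' _ _ := rfl
  map_smul' _ _ := rfl

theorem Hecke.sum_apply {ι : Type*} (s : Finset ι) (f : ι → Hecke K) (x : G) :
    (∑ i ∈ s, f i : Hecke K) x = ∑ i ∈ s, f i x :=
  map_sum (Hecke.eval K x) f s

theorem Hecke.apply_out_mk (a : Hecke K) (g : G) : a (g : G ⧸ K.toSubgroup).out = a g := by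
  obtain ⟨k, hk⟩ := QuotientGroup.mk_out_eq_mul K.toSubgroup g
  rw [hk, a.apply_mul_right _ k.2]

theorem cosetKernel_baseCell {L : Subgroup G} {ψ : G → ℂ} (hψ : IsBiInvariant K.toSubgroup ψ)
    (d : G ⧸ K.toSubgroup) :
    cosetKernel K.toSubgroup ψ (baseCell K.toSubgroup L : G ⧸ K.toSubgroup) d = ψ d.out := by
  have := cosetKernel_mk hψ 1 d.out
  simpa [coe_baseCell] using this

variable [IsTopologicalGroup G]

theorem Hecke.supportedIn_one {L : Subgroup G} (hL : K.toSubgroup ≤ L) :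
    (1 : Hecke K).SupportedIn L := by
  intro x hx
  rw [one_apply] at hx
  exact hL (Set.mem_of_indicator_ne_zero hx)

open scoped MatrixOrder Matrix.Norms.L2Operator in
/-- Left multiplication by `a` is bounded with respect to every positive functional. -/
theorem Hecke.exists_smul_one_sub (hK : IsLocallyFiniteOver K.toSubgroup) (a : Hecke K) :
    ∃ (c : ℝ) (b : Hecke K), 0 ≤ c ∧ (c : ℂ) • (1 : Hecke K) - star a * a = star b * b := by
  classical
  obtain ⟨L, hL, ha⟩ := a.exists_supportedIn hK
  have _ : Fintype (cells K.toSubgroup L) := hL.finite.fintype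
  let A := kernelMatrix K.toSubgroup L (star a * a : Hecke K)
  have hA : IsSelfAdjoint A := by
    change star A = A
    rw [Matrix.star_eq_conjTranspose, ← kernelMatrix_star, star_mul', star_star']
  -- A Hermitian matrix is bounded above by its operator norm times the identity; this norm is the
  -- constant `c`.
  have hle := hA.le_algebraMap_norm_self
  obtain ⟨b, hb⟩ := Hecke.exists_star_mul_self hL
    (a := (‖A‖ : ℂ) • (1 : Hecke K) - star a * a)
    (((Hecke.supportedIn_one hL.le).smul _).sub (ha.star.mul hL ha)) (by
      have h1 := Matrix.le_iff.1 hle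
      have h2 : kernelMatrix K.toSubgroup L ((‖A‖ : ℂ) • (1 : Hecke K) - star a * a : Hecke K) =
          algebraMap ℝ _ ‖A‖ - A := by
        have h3 : kernelMatrix K.toSubgroup L ((‖A‖ : ℂ) • (1 : Hecke K) - star a * a : Hecke K) =
          (‖A‖ : ℂ) • kernelMatrix K.toSubgroup L (1 : Hecke K) - A := rfl
        rw [h3, kernelMatrix_one, Algebra.algebraMap_eq_smul_one]
        rfl
      rwa [h2])
  exact ⟨‖A‖, b, norm_nonneg _, hb⟩

/-- The indicator function of the double coset of `g`. -/
noncomputable def Hecke.doubleCoset (K : CompactOpenSubgroup G) (g : G) : Hecke K :=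
  ⟨Set.indicator (DoubleCoset.doubleCoset g K.toSubgroup K.toSubgroup) fun _ => 1, by
    have hinv : ∀ k ∈ K.toSubgroup, ∀ l ∈ K.toSubgroup, ∀ x,
        Set.indicator (DoubleCoset.doubleCoset g K.toSubgroup K.toSubgroup)
          (fun _ => (1 : ℂ)) (k * x * l) =
        Set.indicator (DoubleCoset.doubleCoset g K.toSubgroup K.toSubgroup)
          (fun _ => (1 : ℂ)) x := by
      intro k hk l hl x
      have h1 : ∀ k ∈ K.toSubgroup, ∀ l ∈ K.toSubgroup, ∀ x,
          x ∈ DoubleCoset.doubleCoset g (K.toSubgroup : Set G) K.toSubgroup →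
          k * x * l ∈ DoubleCoset.doubleCoset g (K.toSubgroup : Set G) K.toSubgroup := by
        intro k hk l hl x hx
        obtain ⟨p, hp, r, hr, rfl⟩ := DoubleCoset.mem_doubleCoset.1 hx
        exact DoubleCoset.mem_doubleCoset.2
          ⟨k * p, mul_mem hk hp, r * l, mul_mem hr hl, by group⟩
      by_cases h : x ∈ DoubleCoset.doubleCoset g (K.toSubgroup : Set G) K.toSubgroup
      · rw [Set.indicator_of_mem h, Set.indicator_of_mem (h1 k hk l hl x h)]
      · rw [Set.indicator_of_notMem h, Set.indicator_of_notMem fun h' => h ?_]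
        have := h1 k⁻¹ (K.toSubgroup.inv_mem hk) l⁻¹ (K.toSubgroup.inv_mem hl) _ h'
        simpa [mul_assoc] using this
    refine ⟨isLocallyConstant_of_inv hinv,
      HasCompactSupport.intro ((K.isCompact.mul (isCompact_singleton (x := g))).mul K.isCompact)
        fun x hx => Set.indicator_of_notMem hx _, hinv⟩⟩

theorem Hecke.doubleCoset_apply_of_mem {g x : G}
    (h : x ∈ DoubleCoset.doubleCoset g (K.toSubgroup : Set G) K.toSubgroup) :
    doubleCoset K g x = 1 := Set.indicator_of_mem h fun _ => (1 : ℂ)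

theorem Hecke.mem_of_doubleCoset_apply_ne_zero {g x : G} (h : doubleCoset K g x ≠ 0) :
    x ∈ DoubleCoset.doubleCoset g (K.toSubgroup : Set G) K.toSubgroup :=
  Set.mem_of_indicator_ne_zero (f := fun _ => (1 : ℂ)) h

theorem Hecke.doubleCoset_eq_of_mem {g x : G}
    (h : x ∈ DoubleCoset.doubleCoset g (K.toSubgroup : Set G) K.toSubgroup) :
    doubleCoset K x = doubleCoset K g := by
  apply Subtype.ext
  change Set.indicator _ _ = Set.indicator _ _
  rw [DoubleCoset.doubleCoset_eq_of_mem h]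

theorem Hecke.doubleCoset_self (g : G) : doubleCoset K g g = 1 :=
  doubleCoset_apply_of_mem (DoubleCoset.mem_doubleCoset_self _ _ g)

theorem Hecke.doubleCoset_apply_ne_zero_iff {g x : G} :
    doubleCoset K g x ≠ 0 ↔ doubleCoset K x = doubleCoset K g := by
  refine ⟨fun h => doubleCoset_eq_of_mem (mem_of_doubleCoset_apply_ne_zero h), fun h => ?_⟩
  rw [← h, doubleCoset_self]
  exact one_ne_zero

theorem Hecke.doubleCoset_apply_eq_zero_or_one (g x : G) :
    doubleCoset K g x = 0 ∨ doubleCoset K g x = 1 := by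
  by_cases h : doubleCoset K g x = 0
  · exact Or.inl h
  · exact Or.inr (doubleCoset_apply_of_mem (mem_of_doubleCoset_apply_ne_zero h))

theorem Hecke.doubleCoset_apply_comm (g x : G) : doubleCoset K g x = doubleCoset K x g := by
  by_cases h : doubleCoset K g x = 0
  · rw [h]
    by_contra h'
    exact doubleCoset_apply_ne_zero_iff.2
      (doubleCoset_apply_ne_zero_iff.1 (fun h'' => h' h''.symm)).symm h
  · have h1 := doubleCoset_apply_ne_zero_iff.1 h
    rw [h1, ← h1, doubleCoset_self, h1, doubleCoset_self]

theorem Hecke.doubleCoset_mul (g : G) {k l : G} (hk : k ∈ K.toSubgroup) (hl : l ∈ K.toSubgroup) :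
    doubleCoset K (k * g * l) = doubleCoset K g :=
  doubleCoset_eq_of_mem (DoubleCoset.mem_doubleCoset.2 ⟨k, hk, l, hl, rfl⟩)

theorem Hecke.doubleCoset_inv_apply (g x : G) : doubleCoset K g⁻¹ x = doubleCoset K g x⁻¹ := by
  have key : ∀ g x : G, doubleCoset K g x ≠ 0 → doubleCoset K g⁻¹ x⁻¹ ≠ 0 := by
    intro g x h
    obtain ⟨p, hp, r, hr, rfl⟩ :=
      DoubleCoset.mem_doubleCoset.1 (mem_of_doubleCoset_apply_ne_zero h)
    rw [doubleCoset_apply_of_mem (DoubleCoset.mem_doubleCoset.2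
      ⟨r⁻¹, K.toSubgroup.inv_mem hr, p⁻¹, K.toSubgroup.inv_mem hp, by group⟩)]
    exact one_ne_zero
  rcases doubleCoset_apply_eq_zero_or_one (K := K) g x⁻¹ with h | h
  · rw [h]
    by_contra h'
    have := key _ _ h'
    rw [inv_inv] at this
    exact this h
  · have := key g x⁻¹ (by rw [h]; exact one_ne_zero)
    rw [inv_inv] at this
    rw [h, (doubleCoset_apply_eq_zero_or_one g⁻¹ x).resolve_left this]

theorem Hecke.star_doubleCoset (g : G) : star (doubleCoset K g) = doubleCoset K g⁻¹ := by
  apply ext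
  intro x
  rw [star_apply, doubleCoset_inv_apply]
  rcases doubleCoset_apply_eq_zero_or_one (K := K) g x⁻¹ with h | h <;> simp [h]

theorem Hecke.supportedIn_doubleCoset {L : Subgroup G} (hL : K.toSubgroup ≤ L) {g : G}
    (hg : g ∈ L) : (doubleCoset K g).SupportedIn L := by
  intro x hx
  obtain ⟨p, hp, r, hr, rfl⟩ :=
    DoubleCoset.mem_doubleCoset.1 (mem_of_doubleCoset_apply_ne_zero hx)
  exact mul_mem (mul_mem (hL hp) hg) (hL hr)

/-- The volume of the double coset of `g`. -/
noncomputable def doubleCosetVolume (K : CompactOpenSubgroup G) (g : G) : ℂ :=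
  ∫ x, Hecke.doubleCoset K g x ∂K.haar

variable {L : Subgroup G}

theorem doubleCosetVolume_eq_sum (hL : K.toSubgroup ≤ L) [Fintype (cells K.toSubgroup L)] {g : G}
    (hg : g ∈ L) : doubleCosetVolume K g =
      ∑ c : cells K.toSubgroup L, Hecke.doubleCoset K g (c : G ⧸ K.toSubgroup).out :=
  integral_eq_sum_cells hL _ (fun x _ hk => Hecke.apply_mul_right _ x hk)
    (Hecke.supportedIn_doubleCoset hL hg)

/-- The volume counts the cosets $xK$ inside $KgK$, and $gK$ is one of them. -/
theorem doubleCosetVolume_ne_zero (hK : IsLocallyFiniteOver K.toSubgroup) (g : G) :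
    doubleCosetVolume K g ≠ 0 := by
  obtain ⟨L, hL, hg⟩ := hK {g}
  have hg := hg g (Finset.mem_singleton_self g)
  have _ : Fintype (cells K.toSubgroup L) := hL.finite.fintype
  rw [doubleCosetVolume_eq_sum hL.le hg]
  refine (Finset.sum_pos' (fun c _ => ?_)
    ⟨⟨_, (mk_mem_cells hL.le).2 hg⟩, Finset.mem_univ _, ?_⟩).ne'
  · rcases Hecke.doubleCoset_apply_eq_zero_or_one (K := K) g (c : G ⧸ K.toSubgroup).out with h | h
      <;> simp [h]
  · rw [Hecke.apply_out_mk, Hecke.doubleCoset_self]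
    exact one_pos

/-- This is the unimodularity that is needed. Count the pairs $(c,d)$ in $L/K$ with $c^{-1}d\in
KgK$: by transitivity there are $|L/K|$ times the volume, and exchanging $c$ and $d$ replaces $g$ by
$g^{-1}$. -/
theorem doubleCosetVolume_inv (hK : IsLocallyFiniteOver K.toSubgroup) (g : G) :
    doubleCosetVolume K g⁻¹ = doubleCosetVolume K g := by
  obtain ⟨L, hL, hg⟩ := hK {g}
  have hg := hg g (Finset.mem_singleton_self g)
  have _ : Fintype (cells K.toSubgroup L) := hL.finite.fintype
  have key : ∀ g ∈ L, ∑ c : cells K.toSubgroup L, ∑ d : cells K.toSubgroup L,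
      cosetKernel K.toSubgroup (Hecke.doubleCoset K g) c d =
        Fintype.card (cells K.toSubgroup L) * doubleCosetVolume K g := by
    intro g hg
    rw [sum_sum_invariant _ fun (l : L) c d =>
      cosetKernel_smul (Hecke.doubleCoset K g).isBiInvariant (l : G) c d,
      doubleCosetVolume_eq_sum hL.le hg]
    congr 1
    refine Finset.sum_congr rfl fun d _ => ?_
    have := cosetKernel_mk (Hecke.doubleCoset K g).isBiInvariant 1 (d : G ⧸ K.toSubgroup).out
    simpa [coe_baseCell] using this
  refine mul_left_cancel₀ (card_cells_ne_zero (K := K.toSubgroup) (L := L)) ?_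
  rw [← key g hg, ← key g⁻¹ (inv_mem hg), Finset.sum_comm]
  refine Finset.sum_congr rfl fun d _ => Finset.sum_congr rfl fun c _ => ?_
  rw [cosetKernel, cosetKernel, Hecke.doubleCoset_inv_apply, mul_inv_rev, inv_inv]

/-- The sum runs over cosets rather than double cosets, so each double coset occurs as many times as
it contains cosets, that is, as often as its volume says. The division compensates for this. -/
theorem Hecke.eq_sum_doubleCoset (hK : IsLocallyFiniteOver K.toSubgroup) (hL : K.toSubgroup ≤ L)
    [Fintype (cells K.toSubgroup L)] {h : Hecke K} (hh : h.SupportedIn L) :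
    h = ∑ c : cells K.toSubgroup L,
      (h (c : G ⧸ K.toSubgroup).out / doubleCosetVolume K (c : G ⧸ K.toSubgroup).out) •
        doubleCoset K (c : G ⧸ K.toSubgroup).out := by
  apply ext
  intro x
  rw [sum_apply]
  have key : ∀ c : cells K.toSubgroup L,
      ((h (c : G ⧸ K.toSubgroup).out / doubleCosetVolume K (c : G ⧸ K.toSubgroup).out) •
        doubleCoset K (c : G ⧸ K.toSubgroup).out) x =
      h x / doubleCosetVolume K x * doubleCoset K x (c : G ⧸ K.toSubgroup).out := by
    intro c
    rw [smul_apply, doubleCoset_apply_comm]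
    by_cases h0 : doubleCoset K x (c : G ⧸ K.toSubgroup).out = 0
    · rw [h0, mul_zero, mul_zero]
    · have h1 := mem_of_doubleCoset_apply_ne_zero h0
      obtain ⟨p, hp, r, hr, hc⟩ := DoubleCoset.mem_doubleCoset.1 h1
      have h2 : h (c : G ⧸ K.toSubgroup).out = h x := by rw [hc, h.biInv hp hr]
      rw [h2, doubleCosetVolume, doubleCoset_eq_of_mem h1]
      rfl
  rw [Finset.sum_congr rfl fun c _ => key c, ← Finset.mul_sum]
  by_cases hx : x ∈ L
  · rw [← doubleCosetVolume_eq_sum hL hx, div_mul_cancel₀ _ (doubleCosetVolume_ne_zero hK x)]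
  · have : h x = 0 := by_contra fun h' => hx (hh x h')
    rw [this, zero_div, zero_mul]

/-- The bi-invariant function that represents a linear functional. -/
noncomputable def density (Φ : Hecke K →ₗ[ℂ] ℂ) (g : G) : ℂ :=
  Φ (Hecke.doubleCoset K g) / doubleCosetVolume K g

variable {Φ : Hecke K →ₗ[ℂ] ℂ}

theorem isBiInvariant_density : IsBiInvariant K.toSubgroup (density Φ) := by
  intro k hk l hl g
  rw [density, density, doubleCosetVolume, doubleCosetVolume, Hecke.doubleCoset_mul g hk hl]

/-- The volumes of $KgK$ and $Kg^{-1}K$ are equal and real, and $\star$ exchanges the two indicator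
functions. -/
theorem density_inv (hK : IsLocallyFiniteOver K.toSubgroup) (hstar : ∀ a, Φ (star a) = conj (Φ a))
    (g : G) : density Φ g⁻¹ = conj (density Φ g) := by
  have hvol : conj (doubleCosetVolume K g) = doubleCosetVolume K g := by
    rw [doubleCosetVolume]
    let _ : MeasurableSpace G := borel G
    rw [← integral_conj]
    congr 1
    funext x
    rcases Hecke.doubleCoset_apply_eq_zero_or_one (K := K) g x with h | h <;> simp [h]
  rw [density, density, doubleCosetVolume_inv hK, ← Hecke.star_doubleCoset, hstar, map_div₀, hvol]

/-- The division by the volume in `density` is what turns $\Phi(h)$ into the integral of $h$ against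
the density. -/
theorem map_eq_sum_density (hK : IsLocallyFiniteOver K.toSubgroup) (hL : K.toSubgroup ≤ L)
    [Fintype (cells K.toSubgroup L)] {h : Hecke K} (hh : h.SupportedIn L) :
    Φ h = ∑ c : cells K.toSubgroup L,
      h (c : G ⧸ K.toSubgroup).out * density Φ (c : G ⧸ K.toSubgroup).out := by
  conv_lhs => rw [Hecke.eq_sum_doubleCoset hK hL hh]
  rw [map_sum]
  refine Finset.sum_congr rfl fun c _ => ?_
  rw [map_smul, smul_eq_mul, density]
  ring

/-- The density represents the sesquilinear form of the functional. -/
theorem map_star_mul_eq_sum (hK : IsLocallyFiniteOver K.toSubgroup)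
    (hL : IsFiniteOver K.toSubgroup L) [Fintype (cells K.toSubgroup L)] {a b : Hecke K}
    (ha : a.SupportedIn L) (hb : b.SupportedIn L) :
    Φ (star a * b) = ∑ c : cells K.toSubgroup L, ∑ d : cells K.toSubgroup L,
      conj (a (c : G ⧸ K.toSubgroup).out) * b (d : G ⧸ K.toSubgroup).out *
        cosetKernel K.toSubgroup (density Φ) c d := by
  have hφ := isBiInvariant_density (Φ := Φ)
  refine mul_left_cancel₀ (card_cells_ne_zero (K := K.toSubgroup) (L := L)) ?_
  -- Both matrices are invariant, so the single sum for $\Phi(a^\star b)$, multiplied by $|L/K|$,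
  -- becomes a sum over all pairs of cosets.
  have h1 : (Fintype.card (cells K.toSubgroup L) : ℂ) * Φ (star a * b) =
      ∑ c : cells K.toSubgroup L, ∑ d : cells K.toSubgroup L,
        kernelMatrix K.toSubgroup L (star a * b : Hecke K) c d *
          kernelMatrix K.toSubgroup L (density Φ) c d := by
    rw [sum_sum_invariant _ fun (l : L) c d => by
      rw [kernelMatrix_smul hφ, kernelMatrix_smul (star a * b).isBiInvariant],
      map_eq_sum_density hK hL.le (ha.star.mul hL hb)]
    congr 1
    refine Finset.sum_congr rfl fun d _ => ?_
    rw [kernelMatrix_apply, kernelMatrix_apply, cosetKernel_baseCell hφ,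
      cosetKernel_baseCell (star a * b).isBiInvariant]
  rw [h1, kernelMatrix_mul hL.le ha.star, kernelMatrix_star]
  -- Expanding the product matrix gives one double sum for each intermediate coset `e`. Translating
  -- the base coset to `e` shows that it does not depend on `e`, so the factor $|L/K|$ cancels.
  have h2 : ∀ e : cells K.toSubgroup L, ∑ c : cells K.toSubgroup L, ∑ d : cells K.toSubgroup L,
      conj (kernelMatrix K.toSubgroup L a e c) * kernelMatrix K.toSubgroup L b e d *
          kernelMatrix K.toSubgroup L (density Φ) c d =
      ∑ c : cells K.toSubgroup L, ∑ d : cells K.toSubgroup L,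
        conj (a (c : G ⧸ K.toSubgroup).out) * b (d : G ⧸ K.toSubgroup).out *
          cosetKernel K.toSubgroup (density Φ) c d := by
    intro e
    obtain ⟨g, rfl⟩ := exists_smul_baseCell e
    rw [← Equiv.sum_comp (MulAction.toPerm g)]
    refine Finset.sum_congr rfl fun c _ => ?_
    rw [← Equiv.sum_comp (MulAction.toPerm g)]
    refine Finset.sum_congr rfl fun d _ => ?_
    simp only [MulAction.toPerm_apply]
    rw [kernelMatrix_smul hφ, kernelMatrix_smul a.isBiInvariant, kernelMatrix_smul b.isBiInvariant,
      kernelMatrix_apply, kernelMatrix_apply, kernelMatrix_apply,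
      cosetKernel_baseCell a.isBiInvariant, cosetKernel_baseCell b.isBiInvariant]
  rw [← nsmul_eq_mul, ← Finset.card_univ, ← Finset.sum_const,
    ← Finset.sum_congr rfl fun e _ => h2 e]
  refine Eq.trans (Finset.sum_congr rfl fun c _ => ?_) Finset.sum_comm
  refine Eq.trans (Finset.sum_congr rfl fun d _ => ?_) Finset.sum_comm
  rw [Matrix.mul_apply, Finset.sum_mul]
  rfl

/-- Only invariant positive `N` have to be tested. The transpose of such an `N` is the matrix of
some $b^\star b$, and the trace of the product is $|L/K|\,\Phi(b^\star b)\ge0$. The transpose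
appears because the trace pairs the entry $(c,d)$ with the entry $(d,c)$. -/
theorem posSemidef_kernelMatrix_density (hK : IsLocallyFiniteOver K.toSubgroup)
    (hL : IsFiniteOver K.toSubgroup L) (hstar : ∀ a, Φ (star a) = conj (Φ a))
    (hpos : ∀ a, 0 ≤ Φ (star a * a)) :
    (kernelMatrix K.toSubgroup L (density Φ)).PosSemidef := by
  classical
  have _ : Fintype (cells K.toSubgroup L) := hL.finite.fintype
  have hφ := isBiInvariant_density (Φ := Φ)
  refine Matrix.IsHermitian.posSemidef_of_trace_invariant ?_ fun N hN hinv => ?_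
  · ext c d
    rw [Matrix.conjTranspose_apply, kernelMatrix_apply, kernelMatrix_apply, cosetKernel,
      cosetKernel]
    have := density_inv hK hstar ((c : G ⧸ K.toSubgroup).out⁻¹ * (d : G ⧸ K.toSubgroup).out)
    rw [mul_inv_rev, inv_inv] at this
    rw [this]
    exact Complex.conj_conj _
  · have hN' : ∀ (g : L) c d, N.transpose (g • c) (g • d) = N.transpose c d := fun g c d =>
      hinv (MulAction.toPerm g) (kernelMatrix_smul hφ g) d c
    obtain ⟨a, ha, haN⟩ := exists_hecke_of_invariant hL N.transpose hN'
    obtain ⟨b, rfl⟩ := Hecke.exists_star_mul_self hL ha (by rw [haN]; exact hN.transpose)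
    have h1 : (kernelMatrix K.toSubgroup L (density Φ) * N).trace =
        Fintype.card (cells K.toSubgroup L) * Φ (star b * b) := by
      rw [Matrix.trace]
      simp only [Matrix.diag_apply, Matrix.mul_apply]
      rw [map_eq_sum_density hK hL.le ha, sum_sum_invariant _ fun (g : L) c d => by
        rw [kernelMatrix_smul hφ]; exact congrArg _ (hN' g c d)]
      congr 1
      refine Finset.sum_congr rfl fun d _ => ?_
      have h2 : N d (baseCell K.toSubgroup L) =
          kernelMatrix K.toSubgroup L (star b * b : Hecke K) (baseCell _ _) d := by rw [haN]; rfl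
      rw [h2, kernelMatrix_apply, kernelMatrix_apply, cosetKernel_baseCell hφ,
        cosetKernel_baseCell (star b * b).isBiInvariant, mul_comm]
    rw [h1]
    exact mul_nonneg card_cells_pos.le (hpos b)

end Density

/-! ### The unitary representation defined by an invariant positive kernel -/

section Kernel

/-- The space is the reproducing kernel Hilbert space of `k`, with scalars regarded as operators on
$\mathbb C$; `δ x` is the kernel function at `x` applied to $1$. -/
theorem exists_hilbert_of_posSemidef {X : Type u} (k : Matrix X X ℂ) (hk : k.PosSemidef) :
    ∃ (H : Type u) (_ : NormedAddCommGroup H) (_ : InnerProductSpace ℂ H) (_ : CompleteSpace H)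
      (δ : X → H), (∀ x y, inner ℂ (δ x) (δ y) = k x y) ∧
        Dense (Submodule.span ℂ (Set.range δ) : Set H) := by
  let K : Matrix X X (ℂ →L[ℂ] ℂ) := Matrix.of fun x y => k x y • ContinuousLinearMap.id ℂ ℂ
  have hK : K.PosSemidef := by
    have htfae := (RKHS.posSemidef_tfae (K := K)).out 0 2
    refine htfae.2 ⟨?_, fun f => ?_⟩
    · ext x y
      rw [Matrix.conjTranspose_apply, ContinuousLinearMap.star_eq_adjoint]
      change (ContinuousLinearMap.adjoint (k y x • ContinuousLinearMap.id ℂ ℂ)) 1 =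
        (k x y • ContinuousLinearMap.id ℂ ℂ) 1
      rw [map_smulₛₗ, ContinuousLinearMap.adjoint_id]
      have := hk.1.apply x y
      simpa using this
    · have := (Complex.nonneg_iff.1 (hk.2 f)).1
      refine this.trans_eq (congrArg Complex.re ?_)
      refine Finsupp.sum_congr fun x _ => Finsupp.sum_congr fun y _ => ?_
      change _ = inner ℂ (k y x * f x) (f y)
      rw [← hk.1.apply x y, RCLike.inner_apply, map_mul]
      simp only [RCLike.star_def]
      ring
  have _ : Fact K.PosSemidef := ⟨hK⟩
  refine ⟨RKHS.OfKernel K, inferInstance, inferInstance, inferInstance,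
    fun x => RKHS.kerFun (RKHS.OfKernel K) x 1, fun x y => ?_, ?_⟩
  · rw [← RKHS.kernel_inner, RKHS.OfKernel.kernel_ofKernel]
    change inner ℂ (k y x * 1) (1 : ℂ) = k x y
    rw [← hk.1.apply x y, RCLike.inner_apply]
    simp
  · rw [Submodule.dense_iff_topologicalClosure_eq_top, ← RKHS.kerFun_dense]
    congr 1
    refine le_antisymm (Submodule.span_mono ?_) (Submodule.span_le.2 ?_)
    · rintro _ ⟨x, rfl⟩
      exact ⟨x, 1, rfl⟩
    · rintro _ ⟨x, v, rfl⟩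
      have : RKHS.kerFun (RKHS.OfKernel K) x v = v • RKHS.kerFun (RKHS.OfKernel K) x 1 := by
        rw [← map_smul, smul_eq_mul, mul_one]
      rw [this]
      exact Submodule.smul_mem _ _ (Submodule.subset_span ⟨x, rfl⟩)

variable {G : Type u} [Group G] [TopologicalSpace G] [IsTopologicalGroup G]
  {X : Type u} [MulAction G X]
  {H : Type u} [NormedAddCommGroup H] [InnerProductSpace ℂ H] [CompleteSpace H]

/-- Permuting the vectors `δ x` preserves their Gram matrix, so it extends to an isometry of the
closed span, which is `H`. Open stabilizers make $g\mapsto\delta(gx)$ locally constant. -/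
theorem exists_unitaryRepr_of_invariant (δ : X → H)
    (hδ : Dense (Submodule.span ℂ (Set.range δ) : Set H))
    (hinv : ∀ (g : G) x y, inner ℂ (δ (g • x)) (δ (g • y)) = inner ℂ (δ x) (δ y))
    (hopen : ∀ x : X, IsOpen {g : G | g • x = x}) :
    ∃ ρ : UnitaryRepr G H, ∀ g x, ρ.toHom g (δ x) = δ (g • x) := by
  let e : (X →₀ ℂ) →ₗ[ℂ] H := Finsupp.linearCombination ℂ δ
  let f : G → (X →₀ ℂ) →ₗ[ℂ] H := fun g => Finsupp.linearCombination ℂ fun x => δ (g • x)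
  have he : DenseRange e := by
    rw [DenseRange, ← LinearMap.coe_range, Finsupp.range_linearCombination]
    exact hδ
  have hfe : ∀ g v, ‖f g v‖ = ‖e v‖ := by
    intro g v
    have : inner ℂ (f g v) (f g v) = inner ℂ (e v) (e v) := by
      simp only [f, e, Finsupp.linearCombination_apply, Finsupp.sum_inner, Finsupp.inner_sum,
        inner_smul_left, inner_smul_right, hinv]
    rw [inner_self_eq_norm_sq_to_K, inner_self_eq_norm_sq_to_K] at this
    have h2 : ‖f g v‖ ^ 2 = ‖e v‖ ^ 2 := by exact_mod_cast this
    exact (sq_eq_sq₀ (norm_nonneg _) (norm_nonneg _)).1 h2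
  have hbound : ∀ g, ∃ C, ∀ v, ‖f g v‖ ≤ C * ‖e v‖ := fun g =>
    ⟨1, fun v => by rw [one_mul, hfe]⟩
  let T : G → H →L[ℂ] H := fun g => (f g).extendOfNorm e
  have hTe : ∀ g v, T g (e v) = f g v := fun g => LinearMap.extendOfNorm_eq he (hbound g)
  have hT : ∀ g x, T g (δ x) = δ (g • x) := by
    intro g x
    have := hTe g (Finsupp.single x 1)
    simpa [e, f] using this
  have hnorm : ∀ g v, ‖T g v‖ = ‖v‖ := by
    intro g v
    refine he.induction_on v (isClosed_eq (by fun_prop) (by fun_prop)) fun w => ?_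
    rw [hTe, hfe]
  have hmul : ∀ g h, T (g * h) = T g * T h := by
    intro g h
    refine ContinuousLinearMap.ext_on hδ ?_
    rintro _ ⟨x, rfl⟩
    change _ = T g (T h (δ x))
    rw [hT, hT, hT, mul_smul]
  have hone : T 1 = 1 := by
    refine ContinuousLinearMap.ext_on hδ ?_
    rintro _ ⟨x, rfl⟩
    change _ = δ x
    rw [hT, one_smul]
  have hinvT : ∀ g v, T g (T g⁻¹ v) = v := by
    intro g v
    have : (T g * T g⁻¹) v = v := by
      rw [← hmul, mul_inv_cancel, hone]
      rfl
    exact this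
  let ρ : G →* (H ≃ₗᵢ[ℂ] H) :=
    { toFun := fun g =>
        { toLinearEquiv := LinearEquiv.ofLinearMap (T g : H →ₗ[ℂ] H) (T g⁻¹ : H →ₗ[ℂ] H)
            (LinearMap.ext fun v => hinvT g v)
            (LinearMap.ext fun v => by simpa using hinvT g⁻¹ v)
          norm_map' := hnorm g }
      map_one' := LinearIsometryEquiv.ext fun v => congrArg (fun S : H →L[ℂ] H => S v) hone
      map_mul' := fun g h =>
        LinearIsometryEquiv.ext fun v => congrArg (fun S : H →L[ℂ] H => S v) (hmul g h) }
  have hρ : ∀ g v, ρ g v = T g v := fun _ _ => rfl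
  have hcont : ∀ x, Continuous fun g : G => δ (g • x) := by
    intro x
    refine IsLocallyConstant.continuous (IsLocallyConstant.comp ?_ δ)
    rw [IsLocallyConstant.iff_exists_open]
    intro g
    refine ⟨(fun h => g⁻¹ * h) ⁻¹' {g : G | g • x = x}, (hopen x).preimage (by fun_prop),
      by simp, fun h hh => ?_⟩
    have hh' : (g⁻¹ * h) • x = x := hh
    rw [mul_smul, inv_smul_eq_iff] at hh'
    exact hh'
  have hcont' : ∀ w, Continuous fun g : G => T g (e w) := by
    intro w
    simp_rw [hTe]
    change Continuous fun g : G => Finsupp.linearCombination ℂ (fun x => δ (g • x)) w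
    simp only [Finsupp.linearCombination_apply, Finsupp.sum]
    exact continuous_finsetSum _ fun x _ => (hcont x).const_smul _
  refine ⟨⟨ρ, fun v => ?_⟩, hT⟩
  -- The operators are isometries, so approximating `v` by a finite combination of the `δ x`
  -- approximates its orbit map uniformly in `g`.
  refine continuous_of_uniform_approx_of_continuous fun u hu => ?_
  obtain ⟨ε, hε, hu⟩ := Metric.mem_uniformity_dist.1 hu
  obtain ⟨w, hw⟩ := he.exists_dist_lt v hε
  refine ⟨fun g => T g (e w), hcont' w, fun g => hu ?_⟩
  rw [hρ, dist_eq_norm, ← map_sub, hnorm, ← dist_eq_norm]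
  exact hw

end Kernel

/-! ### The cyclic representation of a positive functional and its fixed vectors -/

section Cyclic

variable {G : Type u} [Group G] [TopologicalSpace G] {K : CompactOpenSubgroup G}

theorem Hecke.apply_out_smul (a : Hecke K) {k : G} (hk : k ∈ K.toSubgroup)
    (c : G ⧸ K.toSubgroup) : a (k • c).out = a c.out := by
  induction c using QuotientGroup.induction_on with | _ x =>
  change a ((k * x : G) : G ⧸ K.toSubgroup).out = _
  rw [apply_out_mk, apply_out_mk, a.apply_mul_left _ hk]

theorem isClosed_fixed {H : Type u} [NormedAddCommGroup H]
    [InnerProductSpace ℂ H] (ρ : UnitaryRepr G H) : IsClosed (ρ.fixed K : Set H) := by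
  have : (ρ.fixed K : Set H) = ⋂ k ∈ K.toSubgroup, {v | ρ.toHom k v = v} := by
    ext v
    simp only [Set.mem_iInter]
    rfl
  rw [this]
  exact isClosed_biInter fun k _ => isClosed_eq (ρ.toHom k).continuous continuous_id

theorem inner_toHom {H : Type u} [NormedAddCommGroup H]
    [InnerProductSpace ℂ H] (ρ : UnitaryRepr G H) (g : G) (v w : H) :
    inner ℂ (ρ.toHom g v) (ρ.toHom g w) = inner ℂ v w := (ρ.toHom g).inner_map_map v w

variable [IsTopologicalGroup G]

theorem isOpen_stabilizer (c : G ⧸ K.toSubgroup) : IsOpen {g : G | g • c = c} := by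
  induction c using QuotientGroup.induction_on with | _ x =>
  have : {g : G | g • (x : G ⧸ K.toSubgroup) = x} =
      (fun g => (g * x)⁻¹ * x) ⁻¹' (K.toSubgroup : Set G) := by
    ext g
    change ((g * x : G) : G ⧸ K.toSubgroup) = x ↔ _
    rw [QuotientGroup.eq]
    rfl
  rw [this]
  exact K.isOpen.preimage (by fun_prop)

/-- Positivity involves finitely many cosets at a time, and these lie in a single $L/K$. -/
theorem posSemidef_cosetKernel_density (hK : IsLocallyFiniteOver K.toSubgroup)
    {Φ : Hecke K →ₗ[ℂ] ℂ} (hstar : ∀ a, Φ (star a) = conj (Φ a))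
    (hpos : ∀ a, 0 ≤ Φ (star a * a)) :
    (Matrix.of (cosetKernel K.toSubgroup (density Φ))).PosSemidef := by
  classical
  constructor
  · ext c d
    obtain ⟨L, hL, hS⟩ := hK.exists_cells {c, d}
    exact (posSemidef_kernelMatrix_density hK hL hstar hpos).1.apply
      ⟨c, hS c (by simp)⟩ ⟨d, hS d (by simp)⟩
  · intro f
    obtain ⟨L, hL, hS⟩ := hK.exists_cells f.support
    have h := (posSemidef_kernelMatrix_density hK hL hstar hpos).2
      (f.subtypeDomain (· ∈ cells K.toSubgroup L))
    have h1 : ∀ (i : G ⧸ K.toSubgroup) (xi : ℂ),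
        ((f.subtypeDomain (· ∈ cells K.toSubgroup L)).sum fun j xj =>
          star xi * Matrix.of (cosetKernel K.toSubgroup (density Φ)) i j * xj) =
        f.sum fun j xj => star xi * Matrix.of (cosetKernel K.toSubgroup (density Φ)) i j * xj :=
      fun i xi => Finsupp.sum_subtypeDomain_index
        (h := fun j xj => star xi * Matrix.of (cosetKernel K.toSubgroup (density Φ)) i j * xj) hS
    have h2 := Finsupp.sum_subtypeDomain_index (v := f) (p := (· ∈ cells K.toSubgroup L))
        (h := fun i xi => f.sum fun j xj =>
          star xi * Matrix.of (cosetKernel K.toSubgroup (density Φ)) i j * xj) hS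
    rw [← h2]
    refine h.trans_eq (Finsupp.sum_congr fun i _ => h1 i _)

/-- The finitely supported function on the cosets defined by an element of the algebra. -/
noncomputable def Hecke.toFinsupp (hK : IsLocallyFiniteOver K.toSubgroup) :
    Hecke K →ₗ[ℂ] (G ⧸ K.toSubgroup →₀ ℂ) where
  toFun a := Finsupp.ofSupportFinite (fun c => a c.out) (by
    obtain ⟨L, hL, ha⟩ := a.exists_supportedIn hK
    refine hL.finite.subset fun c hc => ?_
    have := (mk_mem_cells hL.le).2 (ha _ hc)
    simpa using this)
  map_add' _ _ := Finsupp.ext fun _ => rfl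
  map_smul' _ _ := Finsupp.ext fun _ => rfl

variable {H : Type u} [NormedAddCommGroup H] [InnerProductSpace ℂ H]

theorem Hecke.linearCombination_toFinsupp (hK : IsLocallyFiniteOver K.toSubgroup)
    {L : Subgroup G} (hL : K.toSubgroup ≤ L) [Fintype (cells K.toSubgroup L)] {a : Hecke K}
    (ha : a.SupportedIn L) (δ : G ⧸ K.toSubgroup → H) :
    Finsupp.linearCombination ℂ δ (toFinsupp hK a) =
      ∑ c : cells K.toSubgroup L, a (c : G ⧸ K.toSubgroup).out • δ c := by
  classical
  have hsub : (toFinsupp hK a).support ⊆ (cells K.toSubgroup L).toFinset := by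
    intro c hc
    rw [Finsupp.mem_support_iff] at hc
    have := (mk_mem_cells hL).2 (ha _ hc)
    simpa using this
  rw [Finsupp.linearCombination_apply, Finsupp.sum_of_support_subset _ hsub _ (by simp)]
  exact (Finset.sum_subtype _ (fun c => Set.mem_toFinset) _)

variable [CompleteSpace H]

/-- On a $K$-fixed vector the integrand is constant on the cosets $xK$. -/
theorem UnitaryRepr.operator_eq_sum (ρ : UnitaryRepr G H) {L : Subgroup G}
    (hL : K.toSubgroup ≤ L) [Fintype (cells K.toSubgroup L)] {f : Hecke K} (hf : f.SupportedIn L)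
    {v : H} (hv : v ∈ ρ.fixed K) :
    ρ.operator f v = ∑ c : cells K.toSubgroup L,
      f (c : G ⧸ K.toSubgroup).out • ρ.toHom (c : G ⧸ K.toSubgroup).out v := by
  refine integral_eq_sum_cells hL _ (fun x k hk => ?_) fun x hx => hf x ?_
  · rw [f.apply_mul_right _ hk, map_mul, LinearIsometryEquiv.coe_mul, Function.comp_apply, hv k hk]
  · exact fun h => hx (by rw [h, zero_smul])

/-- The unitary representation defined by a positive functional on the algebra of `(G, K)`. -/
theorem exists_unitaryRepr_of_positive (hK : IsLocallyFiniteOver K.toSubgroup)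
    [Countable (G ⧸ K.toSubgroup)]
    {Φ : Hecke K →ₗ[ℂ] ℂ} (hstar : ∀ a, Φ (star a) = conj (Φ a))
    (hpos : ∀ a, 0 ≤ Φ (star a * a)) :
    ∃ (H : Type u) (_ : NormedAddCommGroup H) (_ : InnerProductSpace ℂ H) (_ : CompleteSpace H)
      (_ : SeparableSpace H) (ρ : UnitaryRepr G H) (J : Hecke K →ₗ[ℂ] H),
      (∀ a b, inner ℂ (J a) (J b) = Φ (star a * b)) ∧
      (∀ f h : Hecke K, ρ.operator f (J h) = J (f * h)) ∧
      (∀ v, v ∈ ρ.fixed K ↔ v ∈ closure (Set.range J)) ∧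
      Dense (Submodule.span ℂ (Set.range fun g => ρ.toHom g (J 1)) : Set H) := by
  classical
  obtain ⟨H, i1, i2, i3, δ, hδ, hdense⟩ :=
    exists_hilbert_of_posSemidef _ (posSemidef_cosetKernel_density hK hstar hpos)
  have hφ := isBiInvariant_density (Φ := Φ)
  obtain ⟨ρ, hρ⟩ := exists_unitaryRepr_of_invariant (G := G) δ hdense
    (fun g x y => by rw [hδ, hδ]; exact cosetKernel_smul hφ g x y) isOpen_stabilizer
  -- $J(a)=\sum_c a(c)\,\delta_c$, which is $\rho(a)$ applied to the vector of the base coset.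
  let J : Hecke K →ₗ[ℂ] H := Finsupp.linearCombination ℂ δ ∘ₗ Hecke.toFinsupp hK
  have hJ : ∀ {L : Subgroup G} (hL : K.toSubgroup ≤ L) [Fintype (cells K.toSubgroup L)]
      {a : Hecke K} (ha : a.SupportedIn L),
      J a = ∑ c : cells K.toSubgroup L, a (c : G ⧸ K.toSubgroup).out • δ c :=
    fun hL _ _ ha => Hecke.linearCombination_toFinsupp hK hL ha δ
  have hJfix : ∀ a, J a ∈ ρ.fixed K := by
    intro a k hk
    obtain ⟨L, hL, ha⟩ := a.exists_supportedIn hK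
    have _ : Fintype (cells K.toSubgroup L) := hL.finite.fintype
    rw [hJ hL.le ha, map_sum]
    refine Eq.trans ?_ (Equiv.sum_comp (MulAction.toPerm (⟨k, hL.le hk⟩ : L))
      fun c : cells K.toSubgroup L => a (c : G ⧸ K.toSubgroup).out • δ c)
    refine Finset.sum_congr rfl fun c _ => ?_
    rw [map_smul, hρ]
    congr 1
    exact (a.apply_out_smul hk c).symm
  have hJ1 : J 1 = δ ((1 : G) : G ⧸ K.toSubgroup) := by
    obtain ⟨L, hL, -⟩ := hK ∅
    have _ : Fintype (cells K.toSubgroup L) := hL.finite.fintype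
    have h1 : ∀ c : cells K.toSubgroup L, (1 : Hecke K) (c : G ⧸ K.toSubgroup).out =
        (1 : Matrix (cells K.toSubgroup L) (cells K.toSubgroup L) ℂ) (baseCell _ _) c := by
      intro c
      rw [← kernelMatrix_one, kernelMatrix_apply, cosetKernel_baseCell (1 : Hecke K).isBiInvariant]
    rw [hJ hL.le (Hecke.supportedIn_one hL.le), Finset.sum_eq_single (baseCell _ _)]
    · rw [h1, Matrix.one_apply_eq, one_smul, coe_baseCell]
    · intro c _ hc
      rw [h1, Matrix.one_apply_ne hc.symm, zero_smul]
    · simp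
  have hδ1 : ∀ g, ρ.toHom g (J 1) = δ (g : G ⧸ K.toSubgroup) := by
    intro g
    rw [hJ1, hρ]
    congr 1
    change ((g * 1 : G) : G ⧸ K.toSubgroup) = g
    rw [mul_one]
  have hspan : Set.range (fun g => ρ.toHom g (J 1)) = Set.range δ := by
    rw [funext hδ1]
    exact (QuotientGroup.mk_surjective (s := K.toSubgroup)).range_comp δ
  -- The vectors `δ c` span a dense subspace, and there are countably many cosets.
  have hsep : SeparableSpace H := by
    rw [← isSeparable_univ_iff, ← hdense.closure_eq]
    exact (Set.countable_range δ).isSeparable.span.closure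
  refine ⟨H, i1, i2, i3, hsep, ρ, J, fun a b => ?_, fun f h => ?_, fun v => ⟨fun hv => ?_, ?_⟩, ?_⟩
  · obtain ⟨L, hL, ha, hb⟩ := a.exists_supportedIn₂ hK b
    have _ : Fintype (cells K.toSubgroup L) := hL.finite.fintype
    rw [map_star_mul_eq_sum hK hL ha hb, hJ hL.le ha, hJ hL.le hb, sum_inner]
    refine Finset.sum_congr rfl fun c _ => ?_
    rw [inner_sum]
    refine Finset.sum_congr rfl fun d _ => ?_
    rw [inner_smul_left, inner_smul_right, hδ, mul_assoc]
    rfl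
  · obtain ⟨L, hL, hf, hh⟩ := f.exists_supportedIn₂ hK h
    have _ : Fintype (cells K.toSubgroup L) := hL.finite.fintype
    rw [ρ.operator_eq_sum hL.le hf (hJfix h), hJ hL.le (hf.mul hL hh)]
    have h1 : ∀ e : cells K.toSubgroup L, (f * h) (e : G ⧸ K.toSubgroup).out =
        ∑ c : cells K.toSubgroup L, f (c : G ⧸ K.toSubgroup).out *
          kernelMatrix K.toSubgroup L h c e := by
      intro e
      have := Hecke.mul_apply_eq_sum hL.le hf h L.one_mem (e : G ⧸ K.toSubgroup).out
      simpa [kernelMatrix_apply, cosetKernel] using this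
    simp_rw [h1, Finset.sum_smul]
    rw [Finset.sum_comm]
    refine Finset.sum_congr rfl fun c _ => ?_
    -- For fixed `c`, translation by its representative matches the expansion of $\rho(c)J(h)$ with
    -- the sum over `e`.
    obtain ⟨g, hg⟩ : ∃ g : L, (g : G) = (c : G ⧸ K.toSubgroup).out :=
      ⟨⟨_, out_mem_of_mem_cells hL.le c.2⟩, rfl⟩
    have hc : g • baseCell K.toSubgroup L = c := by
      apply Subtype.ext
      change (((g : G) * 1 : G) : G ⧸ K.toSubgroup) = c
      rw [mul_one, hg]
      simp
    rw [hJ hL.le hh, map_sum, Finset.smul_sum, ← Equiv.sum_comp (MulAction.toPerm g)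
      (fun e : cells K.toSubgroup L => (f (c : G ⧸ K.toSubgroup).out *
          kernelMatrix K.toSubgroup L h c e) • δ e)]
    refine Finset.sum_congr rfl fun d _ => ?_
    rw [map_smul, hρ, smul_smul, MulAction.toPerm_apply]
    conv_rhs => rw [← hc, kernelMatrix_smul h.isBiInvariant, kernelMatrix_apply,
      cosetKernel_baseCell h.isBiInvariant]
    rw [hc, ← hg]
    rfl
  · let W := (LinearMap.range J).topologicalClosure
    have hW : (W : Set H) = closure (Set.range J) := by
      rw [Submodule.topologicalClosure_coe, LinearMap.coe_range]
    have hWfix : W ≤ ρ.fixed K := by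
      intro w hw
      rw [← SetLike.mem_coe, hW] at hw
      refine closure_minimal ?_ (isClosed_fixed ρ) hw
      rintro _ ⟨a, rfl⟩
      exact hJfix a
    have hcW : CompleteSpace W := (Submodule.isClosed_topologicalClosure _).completeSpace_coe
    -- A fixed vector $w$ has the same inner product with $\delta_c$ for all cosets $c$ in $KgK$.
    -- Its product with $J(1_{KgK})$ is therefore the nonzero volume of $KgK$ times $\langle
    -- w,\delta_{gK}\rangle$; if $w$ is orthogonal to the range of $J$, it is orthogonal to every
    -- $\delta_{gK}$.
    have hbot : Wᗮ ⊓ ρ.fixed K = ⊥ := by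
      rw [eq_bot_iff]
      rintro w ⟨hw, hwfix⟩
      have hδw : ∀ g : G, inner ℂ w (δ (g : G ⧸ K.toSubgroup)) = 0 := by
        intro g
        obtain ⟨L, hL, hg⟩ := hK {g}
        have hg := hg g (Finset.mem_singleton_self g)
        have _ : Fintype (cells K.toSubgroup L) := hL.finite.fintype
        have h0 : inner ℂ w (J (Hecke.doubleCoset K g)) = 0 := by
          rw [← inner_conj_symm, Submodule.inner_right_of_mem_orthogonal ?_ hw, map_zero]
          exact Submodule.le_topologicalClosure _ ⟨_, rfl⟩
        rw [hJ hL.le (Hecke.supportedIn_doubleCoset hL.le hg), inner_sum] at h0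
        have h1 : ∀ c : cells K.toSubgroup L,
            inner ℂ w (Hecke.doubleCoset K g (c : G ⧸ K.toSubgroup).out • δ c) =
            Hecke.doubleCoset K g (c : G ⧸ K.toSubgroup).out *
              inner ℂ w (δ (g : G ⧸ K.toSubgroup)) := by
          intro c
          rw [inner_smul_right]
          by_cases hz : Hecke.doubleCoset K g (c : G ⧸ K.toSubgroup).out = 0
          · rw [hz, zero_mul, zero_mul]
          · obtain ⟨p, hp, r, hr, hc⟩ :=
              DoubleCoset.mem_doubleCoset.1 (Hecke.mem_of_doubleCoset_apply_ne_zero hz)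
            have hc' : (c : G ⧸ K.toSubgroup) = p • (g : G ⧸ K.toSubgroup) := by
              change _ = ((p * g : G) : G ⧸ K.toSubgroup)
              rw [← QuotientGroup.out_eq' (c : G ⧸ K.toSubgroup), hc, QuotientGroup.eq]
              have : (p * g * r)⁻¹ * (p * g) = r⁻¹ := by group
              rw [this]
              exact K.toSubgroup.inv_mem hr
            rw [hc', ← hρ]
            conv_lhs => rw [← hwfix p hp]
            rw [inner_toHom, ← hc']
        rw [Finset.sum_congr rfl fun c _ => h1 c, ← Finset.sum_mul,
          ← doubleCosetVolume_eq_sum hL.le hg] at h0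
        exact (mul_eq_zero.1 h0).resolve_left (doubleCosetVolume_ne_zero hK g)
      have hw0 : w = 0 := by
        refine hdense.eq_zero_of_inner_left ℂ (fun v hv => ?_)
        rw [SetLike.mem_coe] at hv
        induction hv using Submodule.span_induction with
        | mem x hx =>
          obtain ⟨c, rfl⟩ := hx
          obtain ⟨g, rfl⟩ := QuotientGroup.mk_surjective c
          exact hδw g
        | zero => exact inner_zero_right _
        | add x y _ _ hx hy => rw [inner_add_right, hx, hy, add_zero]
        | smul a x _ hx => rw [inner_smul_right, hx, mul_zero]
      rw [hw0]
      exact zero_mem _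
    have := Submodule.sup_orthogonal_inf_of_hasOrthogonalProjection hWfix
    rw [hbot, sup_bot_eq] at this
    rw [← hW, this]
    exact hv
  · refine fun hv => closure_minimal ?_ (isClosed_fixed ρ) hv
    rintro _ ⟨a, rfl⟩
    exact hJfix a
  · rw [hspan]
    exact hdense

end Cyclic

/-! ### The tensor square of the algebra -/

section Tensor

variable {G : Type u} [Group G] [TopologicalSpace G] {K : CompactOpenSubgroup G}

theorem IsLocallyFiniteOver.prod (hK : IsLocallyFiniteOver K.toSubgroup) :
    IsLocallyFiniteOver (K.prod K).toSubgroup := by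
  classical
  intro S
  obtain ⟨L, hL, hS⟩ := hK (S.image Prod.fst ∪ S.image Prod.snd)
  have hle : (K.prod K).toSubgroup ≤ L.prod L := Subgroup.prod_mono hL.le hL.le
  refine ⟨L.prod L, ⟨hle, ?_⟩, fun g hg =>
    ⟨hS _ (Finset.mem_union_left _ (Finset.mem_image_of_mem _ hg)),
      hS _ (Finset.mem_union_right _ (Finset.mem_image_of_mem _ hg))⟩⟩
  refine ((hL.finite.prod hL.finite).image fun p =>
    (((p.1.out, p.2.out) : G × G) : (G × G) ⧸ (K.prod K).toSubgroup)).subset ?_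
  intro c hc
  have h := out_mem_of_mem_cells hle hc
  refine ⟨((c.out.1 : G ⧸ K.toSubgroup), (c.out.2 : G ⧸ K.toSubgroup)),
    ⟨(mk_mem_cells hL.le).2 h.1, (mk_mem_cells hL.le).2 h.2⟩, ?_⟩
  conv_rhs => rw [← QuotientGroup.out_eq' c]
  rw [QuotientGroup.eq]
  constructor
  · change (c.out.1 : G ⧸ K.toSubgroup).out⁻¹ * c.out.1 ∈ K.toSubgroup
    rw [← QuotientGroup.eq]
    simp
  · change (c.out.2 : G ⧸ K.toSubgroup).out⁻¹ * c.out.2 ∈ K.toSubgroup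
    rw [← QuotientGroup.eq]
    simp

theorem countable_quotient_prod [Countable (G ⧸ K.toSubgroup)] :
    Countable ((G × G) ⧸ (K.prod K).toSubgroup) := by
  refine Function.Surjective.countable (f := fun p : (G ⧸ K.toSubgroup) × (G ⧸ K.toSubgroup) =>
    (((p.1.out, p.2.out) : G × G) : (G × G) ⧸ (K.prod K).toSubgroup)) fun c => ?_
  refine ⟨((c.out.1 : G ⧸ K.toSubgroup), (c.out.2 : G ⧸ K.toSubgroup)), ?_⟩
  conv_rhs => rw [← QuotientGroup.out_eq' c]
  rw [QuotientGroup.eq]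
  constructor
  · change (c.out.1 : G ⧸ K.toSubgroup).out⁻¹ * c.out.1 ∈ K.toSubgroup
    rw [← QuotientGroup.eq]
    simp
  · change (c.out.2 : G ⧸ K.toSubgroup).out⁻¹ * c.out.2 ∈ K.toSubgroup
    rw [← QuotientGroup.eq]
    simp

variable [IsTopologicalGroup G]

namespace Hecke

theorem outer_apply (A B : Hecke K) (p : G × G) : outer A B p = A p.1 * B p.2 := rfl

theorem ofTensor_tmul (A B : Hecke K) : ofTensor K (A ⊗ₜ[ℂ] B) = outer A B := rfl

theorem outer_one : outer (1 : Hecke K) 1 = 1 := by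
  apply ext
  rintro ⟨x, y⟩
  rw [outer_apply]
  by_cases hx : x ∈ (K.toSubgroup : Set G)
  · by_cases hy : y ∈ (K.toSubgroup : Set G)
    · rw [one_apply, one_apply, one_apply, Set.indicator_of_mem hx, Set.indicator_of_mem hy,
        Set.indicator_of_mem (s := ((K.prod K).toSubgroup : Set (G × G))) ⟨hx, hy⟩, one_mul]
    · rw [one_apply, one_apply, Set.indicator_of_notMem hy, mul_zero, one_apply,
        Set.indicator_of_notMem (s := ((K.prod K).toSubgroup : Set (G × G))) fun h => hy h.2]
  · rw [one_apply, Set.indicator_of_notMem hx, zero_mul, one_apply,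
      Set.indicator_of_notMem (s := ((K.prod K).toSubgroup : Set (G × G))) fun h => hx h.1]

theorem star_outer (A B : Hecke K) : star (outer A B) = outer (star A) (star B) :=
  ext fun p => map_mul conj (A p.1⁻¹) (B p.2⁻¹)

/-- Both convolutions are finite sums over cosets, and the sum over pairs factors. Hence the Haar
measure of $G\times G$ need not be compared with the product measure. -/
theorem outer_mul (hK : IsLocallyFiniteOver K.toSubgroup) (A B C D : Hecke K) :
    outer A B * outer C D = outer (A * C) (B * D) := by
  obtain ⟨L, hL, hA, hB⟩ := A.exists_supportedIn₂ hK B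
  have _ : Fintype (cells K.toSubgroup L) := hL.finite.fintype
  apply ext
  rintro ⟨x, y⟩
  have h1 := mul_apply_eq_sum hL.le hA C L.one_mem x
  have h2 := mul_apply_eq_sum hL.le hB D L.one_mem y
  simp only [inv_one, one_mul] at h1 h2
  rw [outer_apply, h1, h2, Finset.sum_mul_sum, ← Finset.sum_product', mul_apply,
    Finset.univ_product_univ]
  have hsep : ∀ c d : cells K.toSubgroup L,
      (c : G ⧸ K.toSubgroup).out⁻¹ * (d : G ⧸ K.toSubgroup).out ∈ K.toSubgroup → c = d := by
    intro c d h
    rw [← QuotientGroup.eq] at h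
    exact Subtype.ext (by simpa using h)
  have hcover : ∀ z ∈ L, ∃ c : cells K.toSubgroup L,
      (c : G ⧸ K.toSubgroup).out⁻¹ * z ∈ K.toSubgroup := by
    intro z hz
    refine ⟨⟨(z : G ⧸ K.toSubgroup), (mk_mem_cells hL.le).2 hz⟩, ?_⟩
    rw [← QuotientGroup.eq]
    simp
  rw [(K.prod K).integral_eq_sum
    (fun p : cells K.toSubgroup L × cells K.toSubgroup L =>
      (((p.1 : G ⧸ K.toSubgroup).out, (p.2 : G ⧸ K.toSubgroup).out) : G × G))]
  · refine Finset.sum_congr rfl fun p _ => ?_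
    simp only [outer_apply, Prod.fst_mul, Prod.snd_mul, Prod.fst_inv, Prod.snd_inv]
    ring
  · rintro p r ⟨h1, h2⟩
    exact Prod.ext (hsep _ _ h1) (hsep _ _ h2)
  · intro z k hk
    rw [(outer A B).apply_mul_right z hk, mul_inv_rev, mul_assoc,
      (outer C D).apply_mul_left _ ((K.prod K).toSubgroup.inv_mem hk)]
  · rintro ⟨z, w⟩ h
    have h' := left_ne_zero_of_mul h
    obtain ⟨c, hc⟩ := hcover z (hA z (left_ne_zero_of_mul h'))
    obtain ⟨d, hd⟩ := hcover w (hB w (right_ne_zero_of_mul h'))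
    exact ⟨(c, d), hc, hd⟩

theorem ofTensor_mul (hK : IsLocallyFiniteOver K.toSubgroup) (s t : Hecke K ⊗[ℂ] Hecke K) :
    ofTensor K (s * t) = ofTensor K s * ofTensor K t := by
  induction s using TensorProduct.induction_on with
  | zero => rw [zero_mul, map_zero, zero_mul]
  | add s₁ s₂ h₁ h₂ => rw [add_mul, map_add, map_add, h₁, h₂, add_mul]
  | tmul A B =>
    induction t using TensorProduct.induction_on with
    | zero => rw [mul_zero, map_zero, mul_zero]
    | add t₁ t₂ h₁ h₂ => rw [mul_add, map_add, map_add, h₁, h₂, mul_add]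
    | tmul C D =>
      rw [Algebra.TensorProduct.tmul_mul_tmul, ofTensor_tmul, ofTensor_tmul, ofTensor_tmul,
        outer_mul hK]

theorem doubleCoset_prod (g h : G) :
    doubleCoset (K.prod K) (g, h) = outer (doubleCoset K g) (doubleCoset K h) := by
  apply ext
  rintro ⟨x, y⟩
  rw [outer_apply]
  have key : doubleCoset (K.prod K) (g, h) (x, y) ≠ 0 ↔
      doubleCoset K g x ≠ 0 ∧ doubleCoset K h y ≠ 0 := by
    constructor
    · intro hne
      obtain ⟨p, hp, r, hr, h0⟩ :=
        DoubleCoset.mem_doubleCoset.1 (mem_of_doubleCoset_apply_ne_zero hne)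
      have h1 : x = p.1 * g * r.1 := congrArg Prod.fst h0
      have h2 : y = p.2 * h * r.2 := congrArg Prod.snd h0
      rw [h1, h2, doubleCoset_apply_of_mem (DoubleCoset.mem_doubleCoset.2 ⟨_, hp.1, _, hr.1, rfl⟩),
        doubleCoset_apply_of_mem (DoubleCoset.mem_doubleCoset.2 ⟨_, hp.2, _, hr.2, rfl⟩)]
      exact ⟨one_ne_zero, one_ne_zero⟩
    · rintro ⟨h1, h2⟩
      obtain ⟨p, hp, r, hr, rfl⟩ :=
        DoubleCoset.mem_doubleCoset.1 (mem_of_doubleCoset_apply_ne_zero h1)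
      obtain ⟨p', hp', r', hr', rfl⟩ :=
        DoubleCoset.mem_doubleCoset.1 (mem_of_doubleCoset_apply_ne_zero h2)
      have hp : (p, p') ∈ (K.prod K).toSubgroup := ⟨hp, hp'⟩
      have hr : (r, r') ∈ (K.prod K).toSubgroup := ⟨hr, hr'⟩
      have h3 := doubleCoset_apply_of_mem (K := K.prod K) (g := (g, h))
        (x := (p * g * r, p' * h * r')) (DoubleCoset.mem_doubleCoset.2 ⟨_, hp, _, hr, rfl⟩)
      rw [h3]
      exact one_ne_zero
  rcases doubleCoset_apply_eq_zero_or_one (K := K.prod K) (g, h) (x, y) with h0 | h0 <;>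
  rcases doubleCoset_apply_eq_zero_or_one (K := K) g x with h1 | h1 <;>
  rcases doubleCoset_apply_eq_zero_or_one (K := K) h y with h2 | h2 <;>
  simp_all

/-- The indicators of double cosets span the algebra, and a double coset of $K\times K$ is a product
of double cosets of $K$. -/
theorem ofTensor_surjective (hK : IsLocallyFiniteOver K.toSubgroup) :
    Function.Surjective (ofTensor K) := by
  intro f
  obtain ⟨L, hL, hf⟩ := f.exists_supportedIn hK.prod
  have _ : Fintype (cells (K.prod K).toSubgroup L) := hL.finite.fintype
  rw [eq_sum_doubleCoset hK.prod hL.le hf]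
  change _ ∈ LinearMap.range (ofTensor K)
  refine Submodule.sum_mem _ fun c _ => Submodule.smul_mem _ _ ?_
  exact ⟨doubleCoset K (c : (G × G) ⧸ (K.prod K).toSubgroup).out.1 ⊗ₜ
    doubleCoset K (c : (G × G) ⧸ (K.prod K).toSubgroup).out.2, (doubleCoset_prod _ _).symm⟩

/-- Write $t=\sum b_i\otimes n_i$ with basis elements $b_i$. Fixing the second variable $y$ leaves
$\sum n_i(y)\,b_i=0$, so every $n_i$ vanishes at $y$. -/
theorem ofTensor_injective : Function.Injective (ofTensor K) := by
  classical
  rw [injective_iff_map_eq_zero]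
  intro t ht
  let b := Module.Basis.ofVectorSpace ℂ (Hecke K)
  let e := TensorProduct.equivFinsuppOfBasisLeft (N := Hecke K) b
  obtain ⟨n, rfl⟩ := e.symm.surjective t
  have hn : e.symm n = n.sum fun i x => b i ⊗ₜ[ℂ] x :=
    TensorProduct.equivFinsuppOfBasisLeft_symm_apply b n
  rw [hn, Finsupp.sum, map_sum] at ht
  have hzero : ∀ i, n i = 0 := by
    intro i
    apply ext
    intro y
    have h1 : Finsupp.linearCombination ℂ b (n.mapRange (eval K y) (map_zero _)) = 0 := by
      rw [Finsupp.linearCombination_apply, Finsupp.sum_mapRange_index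
        (h := fun i a => a • b i) fun _ => zero_smul _ _]
      apply ext
      intro x
      rw [Finsupp.sum, sum_apply]
      have h2 := congrArg (eval (K.prod K) (x, y)) ht
      rw [map_sum, map_zero] at h2
      rw [zero_apply, ← h2]
      exact Finset.sum_congr rfl fun i _ => mul_comm _ _
    have h3 := (linearIndependent_iff.1 b.linearIndependent) _ h1
    exact DFunLike.congr_fun h3 i
  have : n = 0 := Finsupp.ext hzero
  rw [this, map_zero]

/-- The identification of the tensor square of the algebra of `(G, K)` with the algebra of
`(G × G, K × K)`. -/
noncomputable def tensorEquiv (hK : IsLocallyFiniteOver K.toSubgroup) :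
    Hecke K ⊗[ℂ] Hecke K ≃ₗ[ℂ] Hecke (K.prod K) :=
  LinearEquiv.ofBijective (ofTensor K) ⟨ofTensor_injective, ofTensor_surjective hK⟩

end Hecke

end Tensor

/-! ### Left and right multiplication in the Hilbert space of a trace -/

section GNS

variable {G : Type u} [Group G] [TopologicalSpace G] [IsTopologicalGroup G]
  {K : CompactOpenSubgroup G} {χ : Hecke K →ₗ[ℂ] ℂ} (hχ : IsTrace χ)

/-- The canonical map to the Hilbert space of the trace as a linear map. -/
noncomputable def toGNSLinear : Hecke K →ₗ[ℂ] GNS hχ :=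
  (UniformSpace.Completion.toComplL (𝕜 := ℂ) (E := PreGNS hχ)).toLinearMap

theorem denseRange_toGNS : DenseRange (toGNS hχ) :=
  UniformSpace.Completion.denseRange_coe (α := PreGNS hχ)

theorem norm_toGNS_sq (X : Hecke K) : ‖toGNS hχ X‖ ^ 2 = (χ (star X * X)).re := by
  rw [← inner_toGNS hχ, inner_self_eq_norm_sq_to_K]
  norm_cast

/-- This is the trace property, $\chi(XX^\star)=\chi(X^\star X)$; it transfers bounds from left to
right multiplications. -/
theorem norm_toGNS_star (X : Hecke K) : ‖toGNS hχ (star X)‖ = ‖toGNS hχ X‖ := by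
  refine (sq_eq_sq₀ (norm_nonneg _) (norm_nonneg _)).1 ?_
  rw [norm_toGNS_sq, norm_toGNS_sq, Hecke.star_star', hχ.tracial]

/-- With $c\cdot1-A^\star A=b^\star b$ one gets $c\|X\|^2-\|AX\|^2=\|bX\|^2\ge0$. -/
theorem exists_norm_mul_left_le (hK : IsLocallyFiniteOver K.toSubgroup) (A : Hecke K) :
    ∃ C, ∀ X, ‖toGNS hχ (A * X)‖ ≤ C * ‖toGNS hχ X‖ := by
  obtain ⟨c, b, hc, hb⟩ := A.exists_smul_one_sub hK
  refine ⟨√c, fun X => ?_⟩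
  have h1 : ‖toGNS hχ (b * X)‖ ^ 2 = c * ‖toGNS hχ X‖ ^ 2 - ‖toGNS hχ (A * X)‖ ^ 2 := by
    rw [norm_toGNS_sq, norm_toGNS_sq, norm_toGNS_sq, Hecke.star_mul', Hecke.star_mul']
    have : star X * star b * (b * X) =
        (c : ℂ) • (star X * X) - star X * star A * (A * X) := by
      rw [mul_assoc, ← mul_assoc (star b), ← hb, sub_mul, mul_sub, smul_mul_assoc, one_mul,
        mul_smul_comm, mul_assoc, mul_assoc]
    rw [this, map_sub, map_smul, Complex.sub_re, smul_eq_mul, Complex.re_ofReal_mul]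
  have h2 : ‖toGNS hχ (A * X)‖ ^ 2 ≤ (√c * ‖toGNS hχ X‖) ^ 2 := by
    rw [mul_pow, Real.sq_sqrt hc]
    nlinarith [sq_nonneg ‖toGNS hχ (b * X)‖]
  exact (sq_le_sq₀ (norm_nonneg _) (by positivity)).1 h2

/-- $XB=(B^\star X^\star)^\star$, and $\star$ is isometric. -/
theorem exists_norm_mul_right_le (hK : IsLocallyFiniteOver K.toSubgroup) (B : Hecke K) :
    ∃ C, ∀ X, ‖toGNS hχ (X * B)‖ ≤ C * ‖toGNS hχ X‖ := by
  obtain ⟨C, hC⟩ := exists_norm_mul_left_le hχ hK (star B)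
  refine ⟨C, fun X => ?_⟩
  have := hC (star X)
  rwa [← Hecke.star_mul', norm_toGNS_star, norm_toGNS_star] at this

theorem gns_ext {S T : GNS hχ →L[ℂ] GNS hχ} (h : ∀ X, S (toGNS hχ X) = T (toGNS hχ X)) :
    S = T :=
  ContinuousLinearMap.ext fun v => (denseRange_toGNS hχ).induction_on v
    (isClosed_eq S.continuous T.continuous) h

/-- Left multiplication by an element of the algebra in the Hilbert space of the trace. -/
noncomputable def leftGNS (A : Hecke K) : GNS hχ →L[ℂ] GNS hχ :=
  (toGNSLinear hχ ∘ₗ LinearMap.mulLeft ℂ A).extendOfNorm (toGNSLinear hχ)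

/-- Right multiplication by an element of the algebra in the Hilbert space of the trace. -/
noncomputable def rightGNS (B : Hecke K) : GNS hχ →L[ℂ] GNS hχ :=
  (toGNSLinear hχ ∘ₗ LinearMap.mulRight ℂ B).extendOfNorm (toGNSLinear hχ)

theorem leftGNS_toGNS (hK : IsLocallyFiniteOver K.toSubgroup) (A X : Hecke K) :
    leftGNS hχ A (toGNS hχ X) = toGNS hχ (A * X) :=
  LinearMap.extendOfNorm_eq (e := toGNSLinear hχ) (denseRange_toGNS hχ)
    (exists_norm_mul_left_le hχ hK A) X

theorem rightGNS_toGNS (hK : IsLocallyFiniteOver K.toSubgroup) (B X : Hecke K) :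
    rightGNS hχ B (toGNS hχ X) = toGNS hχ (X * B) :=
  LinearMap.extendOfNorm_eq (e := toGNSLinear hχ) (denseRange_toGNS hχ)
    (exists_norm_mul_right_le hχ hK B) X

theorem toGNS_add (X Y : Hecke K) : toGNS hχ (X + Y) = toGNS hχ X + toGNS hχ Y :=
  map_add (toGNSLinear hχ) X Y

theorem toGNS_smul (c : ℂ) (X : Hecke K) : toGNS hχ (c • X) = c • toGNS hχ X :=
  map_smul (toGNSLinear hχ) c X

/-- The left regular representation. -/
noncomputable def leftRepr (hK : IsLocallyFiniteOver K.toSubgroup) :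
    Hecke K →ₐ[ℂ] (GNS hχ →L[ℂ] GNS hχ) :=
  AlgHom.ofLinearMap
    { toFun := leftGNS hχ
      map_add' := fun A B => gns_ext hχ fun X => by
        refine Eq.trans ?_ (add_apply _ _ _).symm
        rw [leftGNS_toGNS hχ hK, leftGNS_toGNS hχ hK,
          leftGNS_toGNS hχ hK, add_mul, toGNS_add]
      map_smul' := fun c A => gns_ext hχ fun X => by
        refine Eq.trans ?_ (smul_apply _ _ _).symm
        rw [leftGNS_toGNS hχ hK,
          leftGNS_toGNS hχ hK, smul_mul_assoc, toGNS_smul]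
        rfl }
    (gns_ext hχ fun X => (leftGNS_toGNS hχ hK 1 X).trans (by rw [one_mul]; rfl))
    (fun A B => gns_ext hχ fun X => (leftGNS_toGNS hχ hK (A * B) X).trans (by
      change _ = leftGNS hχ A (leftGNS hχ B (toGNS hχ X))
      rw [leftGNS_toGNS hχ hK, leftGNS_toGNS hχ hK, mul_assoc]))

/-- Right multiplication by the transposed element as a representation. -/
noncomputable def rightRepr (hK : IsLocallyFiniteOver K.toSubgroup) :
    Hecke K →ₐ[ℂ] (GNS hχ →L[ℂ] GNS hχ) :=
  AlgHom.ofLinearMap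
    { toFun := fun B => rightGNS hχ (Hecke.transpose B)
      map_add' := fun A B => gns_ext hχ fun X => by
        refine Eq.trans ?_ (add_apply _ _ _).symm
        rw [rightGNS_toGNS hχ hK, rightGNS_toGNS hχ hK,
          rightGNS_toGNS hχ hK, map_add, mul_add, toGNS_add]
      map_smul' := fun c A => gns_ext hχ fun X => by
        refine Eq.trans ?_ (smul_apply _ _ _).symm
        rw [rightGNS_toGNS hχ hK,
          rightGNS_toGNS hχ hK, map_smul, mul_smul_comm, toGNS_smul]
        rfl }
    (gns_ext hχ fun X => (rightGNS_toGNS hχ hK (Hecke.transpose 1) X).trans (by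
      rw [Hecke.transpose_one, mul_one]; rfl))
    -- Right multiplication and transposition both reverse products, so their composite is
    -- multiplicative.
    (fun A B => gns_ext hχ fun X =>
      (rightGNS_toGNS hχ hK (Hecke.transpose (A * B)) X).trans (by
        change _ = rightGNS hχ (Hecke.transpose A) (rightGNS hχ (Hecke.transpose B) (toGNS hχ X))
        rw [rightGNS_toGNS hχ hK, rightGNS_toGNS hχ hK, Hecke.transpose_mul, mul_assoc]))

/-- The representation of the tensor square by left and right multiplications. -/
noncomputable def leftRightRepr (hK : IsLocallyFiniteOver K.toSubgroup) :
    Hecke K ⊗[ℂ] Hecke K →ₐ[ℂ] (GNS hχ →L[ℂ] GNS hχ) :=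
  Algebra.TensorProduct.lift (leftRepr hχ hK) (rightRepr hχ hK) fun A B =>
    gns_ext hχ fun X => by
      change leftGNS hχ A (rightGNS hχ (Hecke.transpose B) (toGNS hχ X)) =
        rightGNS hχ (Hecke.transpose B) (leftGNS hχ A (toGNS hχ X))
      rw [rightGNS_toGNS hχ hK, leftGNS_toGNS hχ hK, leftGNS_toGNS hχ hK, rightGNS_toGNS hχ hK,
        mul_assoc]

theorem isLeftRightRepr_leftRightRepr (hK : IsLocallyFiniteOver K.toSubgroup) :
    IsLeftRightRepr hχ (leftRightRepr hχ hK) := by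
  intro A B X
  have h : leftRightRepr hχ hK (A ⊗ₜ[ℂ] B) = leftRepr hχ hK A * rightRepr hχ hK B :=
    Algebra.TensorProduct.lift_tmul _ _ _ _ _
  rw [h]
  change leftGNS hχ A (rightGNS hχ (Hecke.transpose B) (toGNS hχ X)) = _
  rw [rightGNS_toGNS hχ hK, leftGNS_toGNS hχ hK, mul_assoc]

variable {hχ}

/-- `τ` respects the involutions: the left factor moves across by $(AX)^\star=X^\star A^\star$, the
right factor by cyclicity of the trace. -/
theorem IsLeftRightRepr.inner_tmul {τ : Hecke K ⊗[ℂ] Hecke K →ₐ[ℂ] (GNS hχ →L[ℂ] GNS hχ)}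
    (hτ : IsLeftRightRepr hχ τ) (A B : Hecke K) (u v : GNS hχ) :
    inner ℂ (τ (star A ⊗ₜ star B) u) v = inner ℂ u (τ (A ⊗ₜ B) v) := by
  refine (denseRange_toGNS hχ).induction_on₂ (isClosed_eq (by fun_prop) (by fun_prop))
    (fun X Y => ?_) u v
  rw [hτ, hτ, inner_toGNS, inner_toGNS, Hecke.star_mul', Hecke.star_mul', Hecke.star_star',
    Hecke.star_transpose, Hecke.star_star', mul_assoc, hχ.tracial]
  simp only [mul_assoc]

/-- The adjoint element `s` is built by additivity from pure tensors and tied to the involution on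
$G\times G$ through `Hecke.ofTensor`. -/
theorem IsLeftRightRepr.exists_star {τ : Hecke K ⊗[ℂ] Hecke K →ₐ[ℂ] (GNS hχ →L[ℂ] GNS hχ)}
    (hτ : IsLeftRightRepr hχ τ) (t : Hecke K ⊗[ℂ] Hecke K) :
    ∃ s, Hecke.ofTensor K s = star (Hecke.ofTensor K t) ∧
      ∀ u v, inner ℂ (τ s u) v = inner ℂ u (τ t v) := by
  induction t using TensorProduct.induction_on with
  | zero =>
    refine ⟨0, ?_, fun u v => ?_⟩
    · rw [map_zero]
      exact Hecke.ext fun x => (map_zero conj).symm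
    · rw [map_zero, zero_apply, zero_apply,
        inner_zero_left, inner_zero_right]
  | tmul A B =>
    exact ⟨star A ⊗ₜ star B, (Hecke.star_outer A B).symm, hτ.inner_tmul A B⟩
  | add t₁ t₂ h₁ h₂ =>
    obtain ⟨s₁, hs₁, h₁⟩ := h₁
    obtain ⟨s₂, hs₂, h₂⟩ := h₂
    refine ⟨s₁ + s₂, ?_, fun u v => ?_⟩
    · rw [map_add, map_add, Hecke.star_add', hs₁, hs₂]
    · rw [map_add, map_add, add_apply, add_apply,
        inner_add_left, inner_add_right, h₁, h₂]

end GNS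

/-! ### Indecomposable traces -/

section Indecomposable

variable {G : Type u} [Group G] [TopologicalSpace G] [IsTopologicalGroup G]
  {K : CompactOpenSubgroup G} {χ : Hecke K →ₗ[ℂ] ℂ} {hχ : IsTrace χ}

theorem inner_toGNS_one (X : Hecke K) : inner ℂ (toGNS hχ 1) (toGNS hχ X) = χ X := by
  rw [inner_toGNS, Hecke.star_one', one_mul]

theorem toGNS_one_ne_zero (hne : χ ≠ 0) : toGNS hχ 1 ≠ 0 := by
  intro h
  refine hne (LinearMap.ext fun X => ?_)
  rw [← inner_toGNS_one (hχ := hχ), h, inner_zero_left, LinearMap.zero_apply]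

/-- The functional `X ↦ ⟨T X, 1⟩`. -/
noncomputable def compressedTrace (hχ : IsTrace χ) (T : GNS hχ →L[ℂ] GNS hχ) : Hecke K →ₗ[ℂ] ℂ :=
  (innerSL ℂ (toGNS hχ 1) ∘L T).toLinearMap ∘ₗ toGNSLinear hχ

theorem compressedTrace_apply (T : GNS hχ →L[ℂ] GNS hχ) (X : Hecke K) :
    compressedTrace hχ T X = inner ℂ (toGNS hχ 1) (T (toGNS hχ X)) := rfl

variable {τ : Hecke K ⊗[ℂ] Hecke K →ₐ[ℂ] (GNS hχ →L[ℂ] GNS hχ)}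

/-- Left multiplication by $Y^\star$ passes through `T` and then crosses the inner product as left
multiplication by $Y$. -/
theorem IsLeftRightRepr.compressedTrace_star_mul (hτ : IsLeftRightRepr hχ τ)
    {T : GNS hχ →L[ℂ] GNS hχ} (hT : ∀ t v, T (τ t v) = τ t (T v)) (X Y : Hecke K) :
    compressedTrace hχ T (star Y * X) = inner ℂ (toGNS hχ Y) (T (toGNS hχ X)) := by
  have h1 : toGNS hχ (star Y * X) = τ (star Y ⊗ₜ 1) (toGNS hχ X) := by
    rw [hτ, Hecke.transpose_one, mul_one]
  rw [compressedTrace_apply, h1, hT, ← hτ.inner_tmul, Hecke.star_star', Hecke.star_one', hτ,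
    Hecke.transpose_one, mul_one, mul_one]

/-- Commuting with left and with right multiplications makes the values at $ab$ and $ba$ both equal
to $\langle Tb,a^\star\rangle$. Positivity is $\langle Ta,a\rangle=\|Ta\|^2$. -/
theorem IsLeftRightRepr.isTrace_compressedTrace (hτ : IsLeftRightRepr hχ τ)
    {T : GNS hχ →L[ℂ] GNS hχ} (hT : ∀ t v, T (τ t v) = τ t (T v))
    (hsa : ∀ u v, inner ℂ (T u) v = inner ℂ u (T v)) (hid : ∀ v, T (T v) = T v) :
    IsTrace (compressedTrace hχ T) where
  tracial a b := by
    have h1 : toGNS hχ (b * a) = τ (1 ⊗ₜ Hecke.transpose a) (toGNS hχ b) := by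
      rw [hτ, Hecke.transpose_transpose, one_mul]
    have h2 := hτ.compressedTrace_star_mul hT b (star a)
    rw [Hecke.star_star'] at h2
    rw [h2, compressedTrace_apply, h1, hT, ← hτ.inner_tmul, Hecke.star_one', hτ,
      Hecke.star_transpose, Hecke.transpose_transpose, one_mul, one_mul]
  map_star a := by
    have h := hτ.compressedTrace_star_mul hT 1 a
    rw [mul_one] at h
    rw [h, ← hsa, compressedTrace_apply, inner_conj_symm]
  nonneg a := by
    rw [hτ.compressedTrace_star_mul hT, ← hid, ← hsa, inner_self_eq_norm_sq_to_K]
    exact pow_nonneg (Complex.zero_le_real.2 (norm_nonneg (T (toGNS hχ a)))) 2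

/-- An orthogonal projection that commutes with the multiplications acts on the unit as a scalar if
the trace is indecomposable. -/
theorem IsLeftRightRepr.exists_smul_of_commute (hτ : IsLeftRightRepr hχ τ)
    (hind : IsIndecomposable χ) {T : GNS hχ →L[ℂ] GNS hχ} (hT : ∀ t v, T (τ t v) = τ t (T v))
    (hsa : ∀ u v, inner ℂ (T u) v = inner ℂ u (T v)) (hid : ∀ v, T (T v) = T v) :
    ∃ c : ℂ, T (toGNS hχ 1) = c • toGNS hχ 1 := by
  -- Proportionality of the functionals says that $T1$ and $c\cdot1$ have the same inner products
  -- with the dense set of all $Y$.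
  have hscalar : ∀ T : GNS hχ →L[ℂ] GNS hχ, (∀ t v, T (τ t v) = τ t (T v)) →
      (∃ c : ℂ, compressedTrace hχ T = c • χ) → ∃ c : ℂ, T (toGNS hχ 1) = c • toGNS hχ 1 := by
    rintro T hT ⟨c, hc⟩
    refine ⟨c, (denseRange_toGNS hχ).eq_of_inner_right ℂ fun Y => ?_⟩
    rw [← hτ.compressedTrace_star_mul hT, hc, inner_smul_right, inner_toGNS]
    rfl
  have hT' : ∀ t v, (1 - T) (τ t v) = τ t ((1 - T) v) := by
    intro t v
    change τ t v - T (τ t v) = τ t (v - T v)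
    rw [hT, map_sub]
  have h2 : IsTrace (compressedTrace hχ (1 - T)) := by
    refine hτ.isTrace_compressedTrace hT' (fun u v => ?_) fun v => ?_
    · change inner ℂ (u - T u) v = inner ℂ u (v - T v)
      rw [inner_sub_left, inner_sub_right, hsa]
    · change v - T v - T (v - T v) = v - T v
      rw [map_sub, hid, sub_self, sub_zero]
  have hsum : χ = ((1 : ℝ) : ℂ) • compressedTrace hχ T +
      ((1 : ℝ) : ℂ) • compressedTrace hχ (1 - T) := by
    apply LinearMap.ext
    intro X
    rw [Complex.ofReal_one, one_smul, one_smul, LinearMap.add_apply, compressedTrace_apply,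
      compressedTrace_apply, ← inner_add_right]
    change χ X = inner ℂ (toGNS hχ 1) (T (toGNS hχ X) + (toGNS hχ X - T (toGNS hχ X)))
    rw [add_sub_cancel, inner_toGNS_one]
  -- By indecomposability one of the two summands is proportional to `χ`. If it is the one of $1-T$,
  -- with scalar $c$ on the unit, then `T` has scalar $1-c$ there.
  by_cases hc1 : ∃ c : ℂ, compressedTrace hχ T = c • χ
  · exact hscalar T hT hc1
  by_cases hc2 : ∃ c : ℂ, compressedTrace hχ (1 - T) = c • χ
  · obtain ⟨c, hc⟩ := hscalar _ hT' hc2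
    refine ⟨1 - c, ?_⟩
    change toGNS hχ 1 - T (toGNS hχ 1) = c • toGNS hχ 1 at hc
    rw [sub_smul, one_smul, ← hc, sub_sub_cancel]
  · exact (hind ⟨_, _, 1, 1, hτ.isTrace_compressedTrace hT hsa hid, h2, one_pos, one_pos, hsum,
      hc1, hc2⟩).elim

end Indecomposable

/-! ### The representation of `G × G` -/

section Main

variable {G : Type u} [Group G] [TopologicalSpace G]

/-- Invariance under $g^{-1}$ keeps $\rho(g)(v-Pv)$ orthogonal to `S`. -/
theorem starProjection_toHom {H : Type u} [NormedAddCommGroup H] [InnerProductSpace ℂ H]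
    (ρ : UnitaryRepr G H) (S : Submodule ℂ H) [S.HasOrthogonalProjection]
    (hS : ∀ g, ∀ v ∈ S, ρ.toHom g v ∈ S) (g : G) (v : H) :
    S.starProjection (ρ.toHom g v) = ρ.toHom g (S.starProjection v) := by
  refine (Submodule.eq_starProjection_of_mem_of_inner_eq_zero
    (hS g _ (Submodule.starProjection_apply_mem S v)) fun w hw => ?_)
  have h : ρ.toHom g (ρ.toHom g⁻¹ w) = w := by
    have : (ρ.toHom g * ρ.toHom g⁻¹) w = w := by
      rw [← map_mul, mul_inv_cancel, map_one]
      rfl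
    exact this
  rw [← map_sub, ← h, inner_toHom]
  exact Submodule.starProjection_inner_eq_zero v _ (hS g⁻¹ w hw)

theorem subset_of_orbit_mem {H : Type u} [NormedAddCommGroup H] [InnerProductSpace ℂ H]
    {ρ : UnitaryRepr G H} {v : H}
    (hcyc : Dense (Submodule.span ℂ (Set.range fun g => ρ.toHom g v) : Set H))
    {S : Submodule ℂ H} (hS : IsClosed (S : Set H)) (hv : ∀ g, ρ.toHom g v ∈ S) : S = ⊤ := by
  rw [eq_top_iff]
  intro w _
  have hle : Submodule.span ℂ (Set.range fun g => ρ.toHom g v) ≤ S :=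
    Submodule.span_le.2 (by rintro _ ⟨g, rfl⟩; exact hv g)
  exact closure_minimal hle hS (hcyc w)

variable [IsTopologicalGroup G] {K : CompactOpenSubgroup G}

/-- All that is needed of the pair $(G,K)$ is local finiteness over $K$ and, for separability,
countability of $G/K$. -/
theorem exists_irreducible_of_indecomposable (hK : IsLocallyFiniteOver K.toSubgroup)
    [Countable (G ⧸ K.toSubgroup)] {χ : Hecke K →ₗ[ℂ] ℂ} (hχ : IsTrace χ) (hne : χ ≠ 0)
    (hind : IsIndecomposable χ) :
    ∃ τ : Hecke K ⊗[ℂ] Hecke K →ₐ[ℂ] (GNS hχ →L[ℂ] GNS hχ),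
      IsLeftRightRepr hχ τ ∧
      ∃ (H : Type u) (_ : NormedAddCommGroup H) (_ : InnerProductSpace ℂ H) (_ : CompleteSpace H)
        (_ : TopologicalSpace.SeparableSpace H) (ρ : UnitaryRepr (G × G) H),
        ρ.IsIrreducible ∧
        ∃ U : GNS hχ ≃ₗᵢ[ℂ] ρ.fixed (K.prod K),
          ∀ (t : Hecke K ⊗[ℂ] Hecke K) (v : GNS hχ),
            ((U (τ t v) : ρ.fixed (K.prod K)) : H) =
              ρ.operator (Hecke.ofTensor K t) (U v : H) := by
  let τ := leftRightRepr hχ hK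
  have hτ : IsLeftRightRepr hχ τ := isLeftRightRepr_leftRightRepr hχ hK
  let v₀ := toGNS hχ 1
  have hv₀ : v₀ ≠ 0 := toGNS_one_ne_zero hne
  let vec : Hecke K ⊗[ℂ] Hecke K →ₗ[ℂ] GNS hχ :=
    (ContinuousLinearMap.apply ℂ (GNS hχ) v₀).toLinearMap ∘ₗ τ.toLinearMap
  have hvec : ∀ t, vec t = τ t v₀ := fun _ => rfl
  have hvec1 : vec 1 = v₀ := by rw [hvec, map_one]; rfl
  -- The unit vector is cyclic already for the left factor, since $\tau(X\otimes1)1=X$.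
  have hdense : DenseRange vec := by
    refine (denseRange_toGNS hχ).mono ?_
    rintro _ ⟨X, rfl⟩
    exact ⟨X ⊗ₜ 1, by rw [hvec, hτ, Hecke.transpose_one, mul_one, mul_one]⟩
  -- The matrix coefficient of `τ` at the unit vector, transported to functions on $G\times G$.
  let Φ : Hecke (K.prod K) →ₗ[ℂ] ℂ :=
    (innerSL ℂ v₀).toLinearMap ∘ₗ vec ∘ₗ (Hecke.tensorEquiv hK).symm.toLinearMap
  have hΦ : ∀ t, Φ (Hecke.ofTensor K t) = inner ℂ v₀ (τ t v₀) := by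
    intro t
    change inner ℂ v₀ (vec ((Hecke.tensorEquiv hK).symm (Hecke.tensorEquiv hK t))) = _
    rw [LinearEquiv.symm_apply_apply]
    rfl
  have hΦ2 : ∀ s t, Φ (star (Hecke.ofTensor K s) * Hecke.ofTensor K t) =
      inner ℂ (vec s) (vec t) := by
    intro s t
    obtain ⟨s', hs', hadj⟩ := hτ.exists_star s
    rw [← hs', ← Hecke.ofTensor_mul hK, hΦ, map_mul, ← inner_conj_symm]
    change conj (inner ℂ (τ s' (τ t v₀)) v₀) = _
    rw [hadj, inner_conj_symm]
    rfl
  have hstar : ∀ f, Φ (star f) = conj (Φ f) := by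
    intro f
    obtain ⟨t, rfl⟩ := Hecke.ofTensor_surjective hK f
    obtain ⟨s, hs, hadj⟩ := hτ.exists_star t
    rw [← hs, hΦ, hΦ, ← hadj, inner_conj_symm]
  have hpos : ∀ f, 0 ≤ Φ (star f * f) := by
    intro f
    obtain ⟨t, rfl⟩ := Hecke.ofTensor_surjective hK f
    rw [hΦ2, inner_self_eq_norm_sq_to_K]
    exact pow_nonneg (Complex.zero_le_real.2 (norm_nonneg (vec t))) 2
  have _ := countable_quotient_prod (K := K)
  obtain ⟨H, i1, i2, i3, i4, ρ, J, hJ, hop, hfix, hcyc⟩ :=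
    exists_unitaryRepr_of_positive hK.prod hstar hpos
  have hJnorm : ∀ t, ‖J (Hecke.ofTensor K t)‖ = ‖vec t‖ := by
    intro t
    have h := hJ (Hecke.ofTensor K t) (Hecke.ofTensor K t)
    rw [hΦ2, inner_self_eq_norm_sq_to_K, inner_self_eq_norm_sq_to_K] at h
    have h2 : ‖J (Hecke.ofTensor K t)‖ ^ 2 = ‖vec t‖ ^ 2 := by exact_mod_cast h
    exact (sq_eq_sq₀ (norm_nonneg _) (norm_nonneg _)).1 h2
  -- The families $\tau(t)1$ and $J(t)$ have the same Gram matrix $\Phi(s^\star t)$, so matching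
  -- them defines an isometry.
  let W : GNS hχ →L[ℂ] H := (J ∘ₗ Hecke.ofTensor K).extendOfNorm vec
  have hW : ∀ t, W (vec t) = J (Hecke.ofTensor K t) := LinearMap.extendOfNorm_eq hdense
    ⟨1, fun t => by rw [one_mul]; exact (hJnorm t).le⟩
  have hWnorm : ∀ v, ‖W v‖ = ‖v‖ := fun v => hdense.induction_on v
    (isClosed_eq (by fun_prop) (by fun_prop)) fun t => by rw [hW, hJnorm]
  let Wi : GNS hχ →ₗᵢ[ℂ] H := ⟨W.toLinearMap, hWnorm⟩
  have hWinner : ∀ u v, inner ℂ (W u) (W v) = inner ℂ u v := Wi.inner_map_map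
  have hWinj : Function.Injective W := Wi.injective
  have hWfix : ∀ v, W v ∈ ρ.fixed (K.prod K) := by
    intro v
    refine hdense.induction_on v ((isClosed_fixed ρ).preimage W.continuous) fun t => ?_
    rw [hW, hfix]
    exact subset_closure ⟨_, rfl⟩
  have hWsurj : ∀ w ∈ ρ.fixed (K.prod K), ∃ v, W v = w := by
    intro w hw
    have hcl : IsClosed (Set.range W) := Wi.isometry.isClosedEmbedding.isClosed_range
    refine closure_minimal ?_ hcl ((hfix w).1 hw)
    rintro _ ⟨f, rfl⟩
    obtain ⟨t, rfl⟩ := Hecke.ofTensor_surjective hK f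
    exact ⟨vec t, hW t⟩
  -- Writing the operator on fixed vectors as a finite sum makes its continuity and its commutation
  -- with projections immediate.
  have hopsum : ∀ t, ∃ L : Finset (G × G), ∀ w ∈ ρ.fixed (K.prod K),
      ρ.operator (Hecke.ofTensor K t) w =
        ∑ g ∈ L, (Hecke.ofTensor K t) g • ρ.toHom g w := by
    classical
    intro t
    obtain ⟨L, hL, hf⟩ := (Hecke.ofTensor K t).exists_supportedIn hK.prod
    have _ : Fintype (cells (K.prod K).toSubgroup L) := hL.finite.fintype
    refine ⟨Finset.univ.image fun c : cells (K.prod K).toSubgroup L =>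
      (c : (G × G) ⧸ (K.prod K).toSubgroup).out, fun w hw => ?_⟩
    rw [ρ.operator_eq_sum hL.le hf hw, Finset.sum_image]
    intro c _ d _ hcd
    exact Subtype.ext (Quotient.out_injective hcd)
  have hintertwine : ∀ t v, W (τ t v) = ρ.operator (Hecke.ofTensor K t) (W v) := by
    intro t v
    obtain ⟨L, hL⟩ := hopsum t
    rw [hL _ (hWfix v)]
    refine hdense.induction_on v (isClosed_eq (by fun_prop) ?_) fun s => ?_
    · exact continuous_finsetSum _ fun g _ =>
        ((ρ.toHom g).continuous.comp W.continuous).const_smul _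
    · rw [← hL _ (hWfix _), hW, hop, ← Hecke.ofTensor_mul hK, ← hW]
      congr 1
      rw [hvec, hvec, map_mul]
      rfl
  have hJ1 : J 1 = W v₀ := by
    rw [← hvec1, hW, Algebra.TensorProduct.one_def, Hecke.ofTensor_tmul, Hecke.outer_one]
  have hJ1ne : J 1 ≠ 0 := by
    rw [hJ1]
    intro h
    exact hv₀ (hWinj (h.trans (map_zero W).symm))
  refine ⟨τ, hτ, H, i1, i2, i3, i4, ρ, ⟨⟨⟨J 1, 0, hJ1ne⟩⟩, fun S hS hinv => ?_⟩, ?_⟩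
  · have hcS : CompleteSpace S := hS.completeSpace_coe
    have hP := starProjection_toHom ρ S hinv
    have hPfix : ∀ w ∈ ρ.fixed (K.prod K), S.starProjection w ∈ ρ.fixed (K.prod K) := by
      intro w hw k hk
      rw [← hP, hw k hk]
    have hPsym : ∀ u v, inner ℂ (S.starProjection u) v = inner ℂ u (S.starProjection v) :=
      fun u v => Submodule.inner_starProjection_left_eq_right S u v
    -- The projection onto `S` commutes with $K\times K$ and so preserves the fixed vectors; `T` is
    -- its restriction carried back to the Hilbert space of `χ`.
    choose T₀ hT₀ using fun v => hWsurj _ (hPfix _ (hWfix v))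
    let T : GNS hχ →L[ℂ] GNS hχ := LinearMap.mkContinuous
      { toFun := T₀
        map_add' := fun u v => hWinj (by rw [hT₀, map_add, map_add, map_add, hT₀, hT₀])
        map_smul' := fun c v => hWinj (by
          rw [hT₀, map_smul, map_smul, map_smul, hT₀, RingHom.id_apply]) } ‖S.starProjection‖
      fun v => by
        change ‖T₀ v‖ ≤ _
        rw [← hWnorm, hT₀, ← hWnorm v]
        exact S.starProjection.le_opNorm _
    have hT : ∀ v, W (T v) = S.starProjection (W v) := hT₀
    have hTτ : ∀ t v, T (τ t v) = τ t (T v) := by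
      intro t v
      apply hWinj
      obtain ⟨L, hL⟩ := hopsum t
      rw [hT, hintertwine, hintertwine, hT, hL _ (hWfix v), hL _ (hPfix _ (hWfix v)), map_sum]
      refine Finset.sum_congr rfl fun g _ => ?_
      rw [map_smul, hP]
    obtain ⟨c, hc⟩ := hτ.exists_smul_of_commute hind hTτ
      (fun u v => by rw [← hWinner, hT, hPsym, ← hT, hWinner])
      (fun v => hWinj (by
        rw [hT, hT]
        exact Submodule.starProjection_eq_self_iff.2 (Submodule.starProjection_apply_mem S _)))
    have hcJ : S.starProjection (J 1) = c • J 1 := by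
      rw [hJ1, ← hT, ← map_smul, ← hc]
    have hcc : c = 0 ∨ c = 1 := by
      have h1 : S.starProjection (S.starProjection (J 1)) = S.starProjection (J 1) :=
        Submodule.starProjection_eq_self_iff.2 (Submodule.starProjection_apply_mem S _)
      rw [hcJ, map_smul, hcJ, smul_smul] at h1
      have h2 : c * c = c := smul_left_injective ℂ hJ1ne h1
      rcases eq_or_ne c 0 with h | h
      · exact Or.inl h
      · exact Or.inr (mul_left_cancel₀ h (h2.trans (mul_one c).symm))
    -- For $c=0$ the orbit of the cyclic vector lies in $S^\perp$, for $c=1$ it lies in `S`.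
    rcases hcc with rfl | rfl
    · left
      rw [zero_smul] at hcJ
      have hperp : Sᗮ = ⊤ := by
        refine subset_of_orbit_mem hcyc (Submodule.isClosed_orthogonal S) fun g => ?_
        rw [← Submodule.starProjection_apply_eq_zero_iff, hP, hcJ, map_zero]
      rw [← Submodule.orthogonal_orthogonal S, hperp, Submodule.top_orthogonal_eq_bot]
    · right
      rw [one_smul] at hcJ
      exact subset_of_orbit_mem hcyc hS fun g =>
        hinv g _ (Submodule.starProjection_eq_self_iff.1 hcJ)
  · let Wc : GNS hχ →ₗᵢ[ℂ] ρ.fixed (K.prod K) :=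
      { toLinearMap := W.toLinearMap.codRestrict _ hWfix
        norm_map' := hWnorm }
    refine ⟨LinearIsometryEquiv.ofSurjective Wc fun w => ?_, hintertwine⟩
    obtain ⟨v, hv⟩ := hWsurj w w.2
    exact ⟨v, Subtype.ext hv⟩

end Main

/-! ### The exhaustion of the group of almost triangular matrices -/

section Exhaustion

variable (F : Type u) [Field F]

/-- The matrices without nonzero entries below the diagonal outside of the first `n` columns
and rows. -/
def flagStabilizer (n : ℕ) : Subgroup (GLB F) where
  carrier := {g | ∀ m, n ≤ m → ∀ x ∈ flag F m, g.1 x ∈ flag F m}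
  mul_mem' := fun ha hb m hm x hx => ha m hm _ (hb m hm x hx)
  one_mem' := fun _ _ _ hx => hx
  inv_mem' := fun ha m hm => inv_flag (ha m hm)

variable {F}

theorem flagStabilizer_mono {m n : ℕ} (h : m ≤ n) : flagStabilizer F m ≤ flagStabilizer F n :=
  fun _ hg k hk => hg k (h.trans hk)

theorem borelSubgroup_le_flagStabilizer (n : ℕ) : borelSubgroup F ≤ flagStabilizer F n :=
  fun g hg m _ => (upper_iff g.1).1 hg m

theorem exists_mem_flagStabilizer (g : GLB F) : ∃ n, g ∈ flagStabilizer F n :=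
  (flag_stable_iff g.1).1 g.2

/-- The coset of an element of the stabilizer is determined by its upper left $n\times n$ block: if
the blocks agree, then $g^{-1}h$ is the identity on the $n$-th flag space and preserves all larger
ones. -/
theorem inv_mul_mem_borelSubgroup {n : ℕ} {g h : GLB F} (hg : g ∈ flagStabilizer F n)
    (hh : h ∈ flagStabilizer F n) (he : ∀ i < n, ∀ j < n, g.entry i j = h.entry i j) :
    g⁻¹ * h ∈ borelSubgroup F := by
  have hgh : ∀ x ∈ flag F n, h.1 x = g.1 x := by
    have : flag F n ≤ LinearMap.eqLocus (h.1 : (ℕ →₀ F) →ₗ[F] (ℕ →₀ F)) g.1 := by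
      apply flag_induction
      intro j hj
      change h.1 _ = g.1 _
      ext i
      by_cases hi : i < n
      · exact (he i hi j hj).symm
      · rw [mem_flag.1 (hg n le_rfl _ (single_mem_flag hj 1)) i (by omega),
          mem_flag.1 (hh n le_rfl _ (single_mem_flag hj 1)) i (by omega)]
    exact fun x hx => this hx
  refine (upper_iff (g⁻¹ * h).1).2 fun m x hx => ?_
  rcases le_total n m with hm | hm
  · exact mul_mem (inv_mem hg) hh m hm x hx
  · have hxn : x ∈ flag F n := mem_flag.2 fun i hi => mem_flag.1 hx i (hm.trans hi)
    have : (g⁻¹ * h).1 x = x := by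
      change g.1.symm (h.1 x) = x
      rw [hgh x hxn, LinearEquiv.symm_apply_apply]
    rw [this]
    exact hx

variable [Finite F]

/-- A finite field admits only finitely many $n\times n$ blocks. -/
theorem isFiniteOver_flagStabilizer (n : ℕ) :
    IsFiniteOver (borelB F).toSubgroup (flagStabilizer F n) := by
  have hle : (borelB F).toSubgroup ≤ flagStabilizer F n := borelSubgroup_le_flagStabilizer n
  refine ⟨hle, ?_⟩
  refine Set.Finite.of_finite_image (f := fun c => fun i j : Fin n => c.out.entry i j)
    (Set.toFinite _) ?_
  intro c hc d hd hcd
  have := inv_mul_mem_borelSubgroup (out_mem_of_mem_cells hle hc) (out_mem_of_mem_cells hle hd)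
    fun i hi j hj => congrFun (congrFun hcd ⟨i, hi⟩) ⟨j, hj⟩
  rw [← QuotientGroup.out_eq' c, ← QuotientGroup.out_eq' d]
  exact QuotientGroup.eq.2 this

theorem isLocallyFiniteOver_borelB : IsLocallyFiniteOver (borelB F).toSubgroup := by
  intro S
  choose n hn using exists_mem_flagStabilizer (F := F)
  exact ⟨_, isFiniteOver_flagStabilizer (S.sup n), fun g hg =>
    flagStabilizer_mono (Finset.le_sup hg) (hn g)⟩

instance countable_quotient_borelB : Countable (GLB F ⧸ (borelB F).toSubgroup) := by
  have h : (⋃ n, cells (borelB F).toSubgroup (flagStabilizer F n)).Countable :=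
    Set.countable_iUnion fun n => (isFiniteOver_flagStabilizer n).finite.countable
  rw [← Set.countable_univ_iff]
  refine h.mono fun c _ => ?_
  obtain ⟨g, rfl⟩ := QuotientGroup.mk_surjective c
  obtain ⟨n, hn⟩ := exists_mem_flagStabilizer g
  exact Set.mem_iUnion.2 ⟨n, (mk_mem_cells (borelSubgroup_le_flagStabilizer n)).2 hn⟩

end Exhaustion

end IwahoriHecke

theorem mainTheorem2 {F : Type u} [Field F] [Finite F]
    (χ : HeckeInf F →ₗ[ℂ] ℂ) (hχ : IsTrace χ) (hne : χ ≠ 0) (hind : IsIndecomposable χ) :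
    ∃ τ : HeckeInf F ⊗[ℂ] HeckeInf F →ₐ[ℂ] (GNS hχ →L[ℂ] GNS hχ),
      IsLeftRightRepr hχ τ ∧
      ∃ (H : Type u) (_ : NormedAddCommGroup H) (_ : InnerProductSpace ℂ H) (_ : CompleteSpace H)
        (_ : TopologicalSpace.SeparableSpace H) (ρ : UnitaryRepr (GLB F × GLB F) H),
        ρ.IsIrreducible ∧
        ∃ U : GNS hχ ≃ₗᵢ[ℂ] ρ.fixed ((borelB F).prod (borelB F)),
          ∀ (t : HeckeInf F ⊗[ℂ] HeckeInf F) (v : GNS hχ),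
            ((U (τ t v) : ρ.fixed ((borelB F).prod (borelB F))) : H) =
              ρ.operator (Hecke.ofTensor (borelB F) t) (U v : H) := by
  exact exists_irreducible_of_indecomposable isLocallyFiniteOver_borelB hχ hne hind
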